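/- **Setting.** Let $\Theta\subset\mathbb R^q$ and $\mathcal X\subset\mathbb R^d$ be convex and compact, and let $f(\theta;x)=\mathbb E[F(\theta;x)]$ be $C^{m+1}$ on $\Theta\times\mathcal X$ for some $m\ge 1$ and strongly convex in $\theta\in\Theta$ for every $x\in\mathcal X$. Assume that the minimizer $\theta_*(x)$ of $f(\cdot;x)$ over $\Theta$ lies in the interior of $\Theta$ for every $x\in\mathcal X$, and that there are constants $K_1,\delta>0$ such that for every $x\in\mathcal X$ there is a matrix $G_x$ whose eigenvalues have positive real parts with $\|\nabla_\theta f(\theta;x)-G_x(\theta-\theta_*(x))\|\le K_1\|\theta-\theta_*(x)\|^2$ whenever $\theta\in\Theta$, $\|\theta-\theta_*(x)\|\le\delta$. *Optimize then predict with PR-SGD and linear regression.* For each $n$ take $n$ design points $x_1,\dots,x_n\in\mathcal X$ (depending on $n$) whose fill distance $\sup_{x\in\mathcal X}\min_i\|x-x_i\|$ and separation distance $\frac12\min_{i\ne j}\|x_i-x_j\|$ are both of exact order $n^{-1/d}$. At each design point run, independently, projected SGD $\theta_0(x_i)\in\Theta$, $\theta_t(x_i)=\Pi_\Theta[\theta_{t-1}(x_i)-\gamma_t\hat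 g_t]$, $t=1,\dots,T$, and report the Polyak–Ruppert average $\bar\theta_T(x_i)=\frac1{T+1}\sum_{t=0}^T\theta_t(x_i)$. Here $\hat g_t=\nabla_\theta f(\theta_{t-1}(x_i);x_i)+\xi_t$ is the gradient estimate from one simulation experiment; relative to the filtration $(\mathcal F_t)$ of the run, $(\xi_t)$ is a square-integrable martingale-difference process and $\mathbb E[\|\xi_t\|^2\mid\mathcal F_{t-1}]+\|\nabla_\theta f(\theta_{t-1};x_i)\|^2\le K_2(1+\|\theta_{t-1}\|^2)$ a.s., with one $K_2$ for all runs. The step sizes satisfy $\gamma_t>0$, $(\gamma_t-\gamma_{t+1})/\gamma_t=o(\gamma_t)$ and $\gamma_t\asymp \log t/t$. Let $\phi=(\phi_1,\dots,\phi_s)^\top$ be basis functions, bounded on $\mathcal X$ and correctly specified: $\theta_*(x)=\beta^\top\phi(x)$ on $\mathcal X$ for some $\beta\in\mathbb R^{s\times q}$. Let $\Phi\in\mathbb R^{n\times s}$ have rows $\phi(x_i)^\top$, assume that $A_n=\frac1n\Phi^\top\Phi$ is invertible for large $n$ with $\|A_n^{-1}\|_{\rm op}=O(1)$, and put $\hat\theta_{LR}(x)=\hat\beta^\top\phi(x)$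 with $\hat\beta=(\Phi^\top\Phi)^{-1}\Phi^\top(\bar\theta_T(x_1),\dots,\bar\theta_T(x_n))^\top$. Fix $x\in\mathcal X$. *Notation.* $u=\tilde O(a)$ means $u=O(a|\log a|^\kappa)$ for some $\kappa>0$. $Z_k=O_{\rm P}(a_k)$ means that for every $\delta>0$ there is $M>0$ with $\Pr(|Z_k|>Ma_k)<\delta$ for all large $k$, and $Z_k=\tilde O_{\rm P}(a_k)$ means $Z_k=O_{\rm P}(a_k|\log a_k|^\kappa)$ for some $\kappa>0$. **Theorem.** 1. For every $j=1,\dots,q$, $\mathbb E[(\hat\theta_{LR}^j(x)-\theta_*^j(x))^2]=\tilde O\!\left(\frac1{T^2}+\frac1{nT}\right)$ as $n,T\to\infty$. 2. Consider allocations $(n,T)$ with $nT=\Gamma$ along budgets $\Gamma\to\infty$. Such an allocation is optimal, i.e. it attains up to a constant factor the minimum of $\frac1{T^2}+\frac1{nT}$ subject to $nT=\Gamma$ (over positive reals), if and only if $T\gtrsim\Gamma^{1/2}$. 3. For every allocation $T^*\gtrsim\Gamma^{1/2}$, $n^*=\Gamma/T^*$ for which $\Phi^\top\Phi$ is (eventually)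 invertible at $n=n^*$, the optimality gap $f(\hat\theta_{LR}(x);x)-f(\theta_*(x);x)$ tends to $0$ in probability as $\Gamma\to\infty$, at the rate $\tilde O_{\rm P}(q\Gamma^{-1})$. -/

import Mathlib

open MeasureTheory ProbabilityTheory Filter Topology Asymptotics
open scoped ENNReal

noncomputable section

namespace OTP

/-- Euclidean space `ℝ^k` with the `L₂` norm. -/
abbrev E (k : ℕ) : Type := EuclideanSpace ℝ (Fin k)

/-! ### Asymptotic notation -/

/-- `u = Õ(a)` along `l`: `u = O(a |log a|^κ)` for some `κ > 0`. -/
def IsSoftO {ι : Type*} (l : Filter ι) (u a : ι → ℝ) : Prop :=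
  ∃ κ : ℝ, 0 < κ ∧ u =O[l] fun i => a i * |Real.log (a i)| ^ κ

/-- `Z = O_P(a)` along `l`: for every `δ > 0` there is `M > 0` such that
`P(|Z i| > M a i) < δ` for all sufficiently large `i`. -/
def IsBigOP {Ω ι : Type*} [MeasurableSpace Ω] (P : Measure Ω) (l : Filter ι)
    (Z : ι → Ω → ℝ) (a : ι → ℝ) : Prop :=
  ∀ δ : ℝ, 0 < δ → ∃ M : ℝ, 0 < M ∧ ∀ᶠ i in l, P {ω | M * a i < |Z i ω|} < ENNReal.ofReal δ

/-- `Z = Õ_P(a)` along `l`: `Z = O_P(a |log a|^κ)` for some `κ > 0`. -/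
def IsSoftOP {Ω ι : Type*} [MeasurableSpace Ω] (P : Measure Ω) (l : Filter ι)
    (Z : ι → Ω → ℝ) (a : ι → ℝ) : Prop :=
  ∃ κ : ℝ, 0 < κ ∧ IsBigOP P l Z fun i => a i * |Real.log (a i)| ^ κ

/-! ### The contextual strongly convex simulation optimization problem -/

/-- The objective `f(θ; x) = 𝔼[F(θ; x)]`, where `S` carries the randomness of one simulation
experiment, distributed according to `ν`. -/
def objective {q d : ℕ} {S : Type*} [MeasurableSpace S] (ν : Measure S)
    (F : E q → E d → S → ℝ) (θ : E q) (x : E d) : ℝ :=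
  ∫ s, F θ x s ∂ν

/-- The optimal-solution function: `optSol Θ f x` is a minimizer of `f(·; x)` over `Θ`
(unique when `f(·; x)` is strongly convex and continuous and `Θ` is convex, compact and
non-empty). -/
def optSol {q d : ℕ} (Θ : Set (E q)) (f : E q → E d → ℝ) (x : E d) : E q :=
  Classical.epsilon fun θ => θ ∈ Θ ∧ IsMinOn (fun θ' => f θ' x) Θ θ

/-- The gradient `∇_θ f(θ; x)` for `θ ∈ Θ` (one-sided on the boundary of `Θ`; no value of `f`
outside `Θ` enters). -/
def gradθ {q d : ℕ} (Θ : Set (E q)) (f : E q → E d → ℝ) (θ : E q) (x : E d) : E q :=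
  gradientWithin (fun θ' => f θ' x) Θ θ

/-- Smoothness and strong convexity: `Θ` and `𝒳` are convex and compact, `f` is `C^{m+1}` on
`Θ × 𝒳` for some `m ≥ 1`, and `f(·; x)` is strongly convex on `Θ` for every `x ∈ 𝒳`. -/
structure SmoothStronglyConvex {q d : ℕ} (Θ : Set (E q)) (X : Set (E d))
    (f : E q → E d → ℝ) : Prop where
  convex_Θ : Convex ℝ Θ
  compact_Θ : IsCompact Θ
  convex_X : Convex ℝ X
  compact_X : IsCompact X
  smooth : ∃ m : ℕ, 1 ≤ m ∧
    ContDiffOn ℝ ((m + 1 : ℕ) : WithTop ℕ∞) (fun p : E q × E d => f p.1 p.2) (Θ ×ˢ X)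
  stronglyConvex : ∀ x ∈ X, ∃ μ : ℝ, 0 < μ ∧ StrongConvexOn Θ μ fun θ => f θ x

/-- The optimal solutions lie in the interior of `Θ`. -/
def InteriorOptimum {q d : ℕ} (Θ : Set (E q)) (X : Set (E d)) (f : E q → E d → ℝ) : Prop :=
  ∀ x ∈ X, optSol Θ f x ∈ interior Θ

/-- Local linearization of the gradient at the optimum with a quadratic error; the linear part
has eigenvalues with positive real parts. The constants are common to all `x ∈ 𝒳`. -/
def LocalLinearization {q d : ℕ} (Θ : Set (E q)) (X : Set (E d)) (f : E q → E d → ℝ) : Prop :=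
  ∃ K₁ δ : ℝ, 0 < δ ∧ ∀ x ∈ X, ∃ G : Matrix (Fin q) (Fin q) ℝ,
    (∀ z ∈ spectrum ℂ (G.map (algebraMap ℝ ℂ)), 0 < z.re) ∧
    ∀ θ ∈ Θ, ‖θ - optSol Θ f x‖ ≤ δ →
      ‖gradθ Θ f θ x - Matrix.toEuclideanCLM (𝕜 := ℝ) G (θ - optSol Θ f x)‖
        ≤ K₁ * ‖θ - optSol Θ f x‖ ^ 2

/-! ### Polyak–Ruppert averaged projected SGD -/

/-- The Euclidean projection `Π_Θ` (a nearest point of `Θ`, unique for `Θ` non-empty, closed and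
convex). -/
def proj {q : ℕ} (Θ : Set (E q)) (y : E q) : E q :=
  Classical.epsilon fun p => p ∈ Θ ∧ ∀ z ∈ Θ, ‖y - p‖ ≤ ‖y - z‖

/-- The SGD iterates `θ_0 ∈ Θ`, `θ_t = Π_Θ[θ_{t-1} - γ_t ĝ_t(θ_{t-1})]`, where
`ĝ t θ ω` is the gradient estimate at `θ` returned by the `t`-th simulation experiment. -/
def sgdIter {q : ℕ} {Ω : Type*} (Θ : Set (E q)) (γ : ℕ → ℝ) (θ₀ : E q)
    (ghat : ℕ → E q → Ω → E q) : ℕ → Ω → E q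
  | 0, _ => θ₀
  | t + 1, ω =>
      proj Θ (sgdIter Θ γ θ₀ ghat t ω - γ (t + 1) • ghat (t + 1) (sgdIter Θ γ θ₀ ghat t ω) ω)

/-- The averaged solution `θ̄_T = (T + 1)⁻¹ ∑_{t=0}^T θ_t`. -/
def prAverage {q : ℕ} {Ω : Type*} (Θ : Set (E q)) (γ : ℕ → ℝ) (θ₀ : E q)
    (ghat : ℕ → E q → Ω → E q) (T : ℕ) (ω : Ω) : E q :=
  ((T : ℝ) + 1)⁻¹ • ∑ t ∈ Finset.range (T + 1), sgdIter Θ γ θ₀ ghat t ω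

/-- The simulation noise `ξ_t = ĝ_t(θ_{t-1}) - ∇_θ f(θ_{t-1}; x)`, here for the index `t + 1`. -/
def noise {q d : ℕ} {Ω : Type*} (Θ : Set (E q)) (f : E q → E d → ℝ) (x : E d) (γ : ℕ → ℝ)
    (θ₀ : E q) (ghat : ℕ → E q → Ω → E q) (t : ℕ) (ω : Ω) : E q :=
  ghat (t + 1) (sgdIter Θ γ θ₀ ghat t ω) ω - gradθ Θ f (sgdIter Θ γ θ₀ ghat t ω) x

/-- Unbiased gradient estimates: relative to the filtration `ℱ` of the run at `x`, the noise is a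
square-integrable martingale-difference process with
`𝔼[‖ξ_t‖² | ℱ_{t-1}] + ‖∇_θ f(θ_{t-1}; x)‖² ≤ K₂ (1 + ‖θ_{t-1}‖²)`. -/
structure MartingaleNoise {q d : ℕ} {Ω : Type*} {mΩ : MeasurableSpace Ω} (P : Measure Ω)
    (ℱ : Filtration ℕ mΩ) (Θ : Set (E q)) (f : E q → E d → ℝ) (x : E d) (γ : ℕ → ℝ)
    (θ₀ : E q) (ghat : ℕ → E q → Ω → E q) (K₂ : ℝ) : Prop where
  adapted : ∀ t, StronglyMeasurable[ℱ (t + 1)]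
    fun ω => ghat (t + 1) (sgdIter Θ γ θ₀ ghat t ω) ω
  memLp : ∀ t, MemLp (noise Θ f x γ θ₀ ghat t) 2 P
  condExp_eq_zero : ∀ t, P[noise Θ f x γ θ₀ ghat t | ℱ t] =ᵐ[P] 0
  condExp_sq_le : ∀ t, ∀ᵐ ω ∂P,
    (P[fun ω' => ‖noise Θ f x γ θ₀ ghat t ω'‖ ^ 2 | ℱ t]) ω
        + ‖gradθ Θ f (sgdIter Θ γ θ₀ ghat t ω) x‖ ^ 2
      ≤ K₂ * (1 + ‖sgdIter Θ γ θ₀ ghat t ω‖ ^ 2)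

/-- Step sizes: `γ_t > 0`, `(γ_t - γ_{t+1}) / γ_t = o(γ_t)`, and `γ_t` is of the order
`log t / t`. -/
structure StepSize (γ : ℕ → ℝ) : Prop where
  pos : ∀ t, 1 ≤ t → 0 < γ t
  slow : (fun t => (γ t - γ (t + 1)) / γ t) =o[atTop] γ
  order : γ =Θ[atTop] fun t : ℕ => Real.log t / t

/-! ### Design of the covariates -/

/-- Fill distance `sup_{x ∈ 𝒳} min_i ‖x - x_i‖`. -/
def fillDist {d n : ℕ} (X : Set (E d)) (pts : Fin n → E d) : ℝ :=
  sSup ((fun x => Metric.infDist x (Set.range pts)) '' X)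

/-- Separation distance `½ min_{i ≠ j} ‖x_i - x_j‖`. -/
def sepDist {d n : ℕ} (pts : Fin n → E d) : ℝ :=
  2⁻¹ * ⨅ p : {p : Fin n × Fin n // p.1 ≠ p.2}, ‖pts p.1.1 - pts p.1.2‖

/-- Quasi-uniform design: `n` points of `𝒳` for every `n`, with fill and separation distances
both of the order `n^{-1/d}`. -/
structure QuasiUniform {d : ℕ} (X : Set (E d)) (pts : (n : ℕ) → Fin n → E d) : Prop where
  mem : ∀ n i, pts n i ∈ X
  fill : (fun n => fillDist X (pts n)) =Θ[atTop] fun n : ℕ => (n : ℝ) ^ (-(1 / (d : ℝ)))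
  sep : (fun n => sepDist (pts n)) =Θ[atTop] fun n : ℕ => (n : ℝ) ^ (-(1 / (d : ℝ)))

/-! ### Linear regression -/

/-- The design matrix `Φ`, with rows `φ(x_i)ᵀ`. -/
def designMatrix {d s n : ℕ} (φ : E d → Fin s → ℝ) (pts : Fin n → E d) :
    Matrix (Fin n) (Fin s) ℝ :=
  Matrix.of fun i l => φ (pts i) l

/-- The least-squares problem has a unique solution: `ΦᵀΦ` is invertible. -/
def Identifiable {d s n : ℕ} (φ : E d → Fin s → ℝ) (pts : Fin n → E d) : Prop :=
  IsUnit ((designMatrix φ pts).transpose * designMatrix φ pts)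

/-- The least-squares coefficients `β̂ = (ΦᵀΦ)⁻¹ Φᵀ Y` for the responses `Y i ∈ ℝ^q`. -/
def lsCoef {d s n q : ℕ} (φ : E d → Fin s → ℝ) (pts : Fin n → E d) (Y : Fin n → E q) :
    Matrix (Fin s) (Fin q) ℝ :=
  ((designMatrix φ pts).transpose * designMatrix φ pts)⁻¹ * (designMatrix φ pts).transpose
    * Matrix.of fun i j => Y i j

/-- The linear-regression prediction `β̂ᵀ φ(x)`. -/
def lrPredict {d s n q : ℕ} (φ : E d → Fin s → ℝ) (pts : Fin n → E d) (Y : Fin n → E q)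
    (x : E d) : E q :=
  WithLp.toLp 2 (Matrix.mulVec (lsCoef φ pts Y).transpose (φ x))

/-- The basis is bounded on `𝒳`. -/
def BoundedBasis {d s : ℕ} (X : Set (E d)) (φ : E d → Fin s → ℝ) : Prop :=
  ∃ B : ℝ, ∀ x ∈ X, ∀ l, |φ x l| ≤ B

/-- The matrices `A_n = n⁻¹ ΦᵀΦ` are well conditioned: for large `n` they are invertible, with
`‖A_n⁻¹‖_op` bounded. -/
def WellConditioned {d s : ℕ} (φ : E d → Fin s → ℝ) (pts : (n : ℕ) → Fin n → E d) : Prop :=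
  ∃ κ : ℝ, ∀ᶠ n : ℕ in atTop, Identifiable φ (pts n) ∧
    ‖Matrix.toEuclideanCLM (𝕜 := ℝ)
      ((n : ℝ)⁻¹ • ((designMatrix φ (pts n)).transpose * designMatrix φ (pts n)))⁻¹‖ ≤ κ

/-- The basis is correctly specified: `θ_*(x) = βᵀ φ(x)` on `𝒳` for some coefficient matrix. -/
def CorrectlySpecified {q d s : ℕ} (Θ : Set (E q)) (X : Set (E d)) (f : E q → E d → ℝ)
    (φ : E d → Fin s → ℝ) : Prop :=
  ∃ β : Matrix (Fin s) (Fin q) ℝ, ∀ x ∈ X, ∀ j, optSol Θ f x j = ∑ l, β l j * φ x l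

/-! ### Optimize then predict, and the allocation of the budget -/

/-- The predicted solution `θ̂_LR(x)`: solve the problem at each of the `n` design points with
`T`-step averaged SGD (the run at the `i`-th point uses the gradient estimates `ghat n i`), then
fit by linear regression and evaluate at `x`. -/
def otpPredict {q d s : ℕ} {Ω : Type*} (Θ : Set (E q)) (γ : ℕ → ℝ) (θ₀ : E d → E q)
    (pts : (n : ℕ) → Fin n → E d) (ghat : (n : ℕ) → Fin n → ℕ → E q → Ω → E q)
    (φ : E d → Fin s → ℝ) (n T : ℕ) (x : E d) (ω : Ω) : E q :=
  lrPredict φ (pts n) (fun i => prAverage Θ γ (θ₀ (pts n i)) (ghat n i) T ω) x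

/-- The order `1/T² + 1/(nT)` of the mean squared error. -/
def mseOrder (n T : ℝ) : ℝ := 1 / T ^ 2 + 1 / (n * T)

/-- The allocations `(n_k, T_k)` of the budgets `Γ_k = n_k T_k` are optimal: they attain, up to a
constant, the minimum of `1/T² + 1/(nT)` subject to `nT = Γ_k`. -/
def OptimalAllocation (n T : ℕ → ℕ) : Prop :=
  ∃ C : ℝ, 0 < C ∧ ∀ᶠ k in atTop, ∀ n' T' : ℝ, 0 < n' → 0 < T' →
    n' * T' = (n k : ℝ) * T k → mseOrder (n k) (T k) ≤ C * mseOrder n' T'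

end OTP

end

noncomputable section

namespace OTP

open scoped RealInnerProductSpace

/-! ### First-order convexity and the minimizers -/

/-! The least-squares weights reproduce every function in the span of the basis, so under correct
specification the prediction error is a weighted sum, with weights of order 1/n, of the errors of n
independent averaged runs (`lrPredict_sub_optSol`, `exists_lrWeight_bound`). Expanding the square
and using independence, the mean squared error is at most a constant times (bias)² + (second
moment)/n of one run (`integral_sq_weighted_sum_le`). It remains to show that bias and second moment
of an averaged run are both of order 1/T up to logarithms, uniformly in the design point
(`SGDRun.exists_moment_bounds`). The uniform constants come from compactness of the covariate set
(`exists_regularField`).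

For one run let e_t be the error of the iterate and G the linear part of the gradient. Strong
monotonicity gives E‖e_t‖² = O(log t / t). If W is bounded and known at time t, then E[W e_{t+1}]
equals (I - γG) E[W e_t] up to sup|W| times a term of order γ(E‖e_t‖² + γ): the noise averages out,
the linearization error is quadratic, and the projection is rarely active. Taking W = 1 bounds the
bias of the iterates by log t / t. Taking W to be a coordinate of e_0 + ... + e_t, with the crude
bound |W| ≤ (t + 1)R, shows that each error has correlation O(log t) with the sum of the earlier
ones, so that this sum has second moment O(t log t). The logarithm in the step size makes 1/t
negligible against γ, so the contraction wins whatever the coercivity constant is.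

On a budget nT = Γ the term 1/(nT) is fixed, so optimality means 1/T² ≲ 1/Γ. The optimality gap is
at most quadratic in the prediction error near the optimum, and Markov's inequality turns the mean
squared error into a rate in probability. -/

/-- First-order inequality for a convex function on a set, with a gradient within the set. -/
lemma convexOn_add_inner_le {q : ℕ} {Θ : Set (E q)} {g : E q → ℝ}
    (hg : ConvexOn ℝ Θ g) {θ θ' v : E q} (hθ : θ ∈ Θ) (hθ' : θ' ∈ Θ)
    (hv : HasGradientWithinAt g v Θ θ) : g θ + ⟪v, θ' - θ⟫ ≤ g θ' := by
  -- On the segment from θ to θ' the claim is that the slope over [0, 1] dominates the derivative at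
  -- 0. Derivatives within the set are enough, so θ may lie on the boundary.
  let L : ℝ →ᵃ[ℝ] E q := AffineMap.lineMap θ θ'
  have hc : ConvexOn ℝ (L ⁻¹' Θ) (g ∘ L) := hg.comp_affineMap L
  have h0 : (0 : ℝ) ∈ L ⁻¹' Θ := by simpa [L] using hθ
  have h1 : (1 : ℝ) ∈ L ⁻¹' Θ := by simpa [L] using hθ'
  have hL : HasDerivWithinAt L (θ' - θ) (L ⁻¹' Θ) 0 := by
    have := (AffineMap.hasDerivAt_lineMap (a := θ) (b := θ') (x := (0 : ℝ)))
    exact this.hasDerivWithinAt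
  have hv' : HasFDerivWithinAt g (InnerProductSpace.toDual ℝ (E q) v) Θ (L 0) := by
    simpa [L] using hasGradientWithinAt_iff_hasFDerivWithinAt.1 hv
  have hd : HasDerivWithinAt (g ∘ L) (⟪v, θ' - θ⟫) (L ⁻¹' Θ) 0 := by
    have := hv'.comp_hasDerivWithinAt (0 : ℝ) hL (Set.mapsTo_preimage _ _)
    simpa using this
  have := hc.le_slope_of_hasDerivWithinAt h0 h1 one_pos hd
  simp [slope_def_field, L] at this
  linarith

section Problem

variable {q d : ℕ} {Θ : Set (E q)} {X : Set (E d)} {f : E q → E d → ℝ}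

lemma SmoothStronglyConvex.continuousOn (h : SmoothStronglyConvex Θ X f) :
    ContinuousOn (fun p : E q × E d => f p.1 p.2) (Θ ×ˢ X) := by
  obtain ⟨m, -, hm⟩ := h.smooth
  exact hm.continuousOn

lemma SmoothStronglyConvex.continuousOn_left (h : SmoothStronglyConvex Θ X f) {x : E d}
    (hx : x ∈ X) : ContinuousOn (fun θ => f θ x) Θ :=
  h.continuousOn.comp (f := fun θ => (θ, x)) (by fun_prop) (fun _ hθ => ⟨hθ, hx⟩)

lemma SmoothStronglyConvex.convexOn (h : SmoothStronglyConvex Θ X f) {x : E d}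
    (hx : x ∈ X) : ConvexOn ℝ Θ (fun θ => f θ x) := by
  obtain ⟨μ, hμ, h⟩ := h.stronglyConvex x hx
  exact UniformConvexOn.convexOn h (fun r => by positivity)

lemma SmoothStronglyConvex.hasGradientWithinAt (h : SmoothStronglyConvex Θ X f) {x : E d}
    (hx : x ∈ X) {θ : E q} (hθ : θ ∈ Θ) :
    HasGradientWithinAt (fun θ' => f θ' x) (gradθ Θ f θ x) Θ θ := by
  obtain ⟨m, -, hm⟩ := h.smooth
  have h1 : DifferentiableOn ℝ (fun p : E q × E d => f p.1 p.2) (Θ ×ˢ X) :=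
    hm.differentiableOn (by simp)
  have h2 : DifferentiableOn ℝ (fun θ' => f θ' x) Θ :=
    h1.comp (f := fun θ => (θ, x)) (by fun_prop) (fun _ hθ => ⟨hθ, hx⟩)
  exact (h2 θ hθ).hasGradientWithinAt

lemma SmoothStronglyConvex.add_inner_le (h : SmoothStronglyConvex Θ X f) {x : E d}
    (hx : x ∈ X) {θ θ' : E q} (hθ : θ ∈ Θ) (hθ' : θ' ∈ Θ) :
    f θ x + ⟪gradθ Θ f θ x, θ' - θ⟫ ≤ f θ' x :=
  convexOn_add_inner_le (h.convexOn hx) hθ hθ' (h.hasGradientWithinAt hx hθ)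

/-- `∇_θ f(·; x)` is monotone on `Θ`. -/
lemma SmoothStronglyConvex.inner_grad_sub_nonneg (h : SmoothStronglyConvex Θ X f) {x : E d}
    (hx : x ∈ X) {θ θ' : E q} (hθ : θ ∈ Θ) (hθ' : θ' ∈ Θ) :
    ⟪gradθ Θ f θ' x, θ - θ'⟫ ≤ ⟪gradθ Θ f θ x, θ - θ'⟫ := by
  have h1 := h.add_inner_le hx hθ hθ'
  have h2 := h.add_inner_le hx hθ' hθ
  have h3 : ⟪gradθ Θ f θ x, θ' - θ⟫ = - ⟪gradθ Θ f θ x, θ - θ'⟫ := by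
    rw [← inner_neg_right, neg_sub]
  linarith

lemma optSol_mem (hint : InteriorOptimum Θ X f) {x : E d} (hx : x ∈ X) : optSol Θ f x ∈ Θ :=
  interior_subset (hint x hx)

/-- `optSol` is an `epsilon` choice and has its defining property only once some minimizer exists;
compactness and continuity provide one. -/
lemma optSol_isMinOn (h : SmoothStronglyConvex Θ X f) (hint : InteriorOptimum Θ X f) {x : E d}
    (hx : x ∈ X) {θ : E q} (hθ : θ ∈ Θ) : f (optSol Θ f x) x ≤ f θ x := by
  obtain ⟨p, hp, hp'⟩ := h.compact_Θ.exists_isMinOn ⟨_, optSol_mem hint hx⟩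
    (h.continuousOn_left hx)
  exact (Classical.epsilon_spec (p := fun θ => θ ∈ Θ ∧ IsMinOn (fun θ' => f θ' x) Θ θ)
    ⟨p, hp, hp'⟩).2 hθ

/-- Quadratic growth of the objective away from its minimizer. -/
lemma quadratic_growth (h : SmoothStronglyConvex Θ X f) (hint : InteriorOptimum Θ X f) {x : E d}
    (hx : x ∈ X) {μ : ℝ} (hμ : StrongConvexOn Θ μ fun θ => f θ x) {θ : E q} (hθ : θ ∈ Θ) :
    f (optSol Θ f x) x + μ / 4 * ‖θ - optSol Θ f x‖ ^ 2 ≤ f θ x := by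
  obtain ⟨hc, hμ'⟩ := hμ
  -- Strong convexity at the midpoint, where the value is at least the minimum. This costs a factor
  -- 2 in the constant but needs no first-order condition.
  have h1 := hμ' hθ (optSol_mem hint hx) (a := 1 / 2) (b := 1 / 2) (by norm_num) (by norm_num)
    (by norm_num)
  have h2 := optSol_isMinOn h hint hx (hc hθ (optSol_mem hint hx) (a := 1 / 2) (b := 1 / 2)
    (by norm_num) (by norm_num) (by norm_num))
  simp only [smul_eq_mul] at h1
  linarith

/-- `f(θ; ·)` is continuous uniformly in `θ ∈ Θ`. -/
lemma SmoothStronglyConvex.eventually_abs_sub_le (h : SmoothStronglyConvex Θ X f) {x₀ : E d}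
    (hx₀ : x₀ ∈ X) {η : ℝ} (hη : 0 < η) :
    ∀ᶠ x in 𝓝[X] x₀, ∀ θ ∈ Θ, |f θ x - f θ x₀| ≤ η := by
  have huc := (h.compact_Θ.prod h.compact_X).uniformContinuousOn_of_continuous h.continuousOn
  rw [Metric.uniformContinuousOn_iff] at huc
  obtain ⟨ε, hε, hu⟩ := huc η hη
  filter_upwards [inter_mem_nhdsWithin X (Metric.ball_mem_nhds x₀ hε)] with x hx θ hθ
  have := hu (θ, x) ⟨hθ, hx.1⟩ (θ, x₀) ⟨hθ, hx₀⟩ (by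
    rw [Prod.dist_eq, dist_self]
    exact max_lt hε hx.2)
  rw [Real.dist_eq] at this
  exact this.le

/-- The optimal solution depends continuously on the covariate. -/
lemma eventually_norm_optSol_sub_lt (h : SmoothStronglyConvex Θ X f)
    (hint : InteriorOptimum Θ X f) {x₀ : E d} (hx₀ : x₀ ∈ X) {ε : ℝ} (hε : 0 < ε) :
    ∀ᶠ x in 𝓝[X] x₀, ‖optSol Θ f x - optSol Θ f x₀‖ < ε := by
  obtain ⟨μ, hμ, hs⟩ := h.stronglyConvex x₀ hx₀
  filter_upwards [h.eventually_abs_sub_le hx₀ (η := μ * ε ^ 2 / 16) (by positivity),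
    self_mem_nhdsWithin] with x hx hxX
  -- Replacing `x₀` by `x` at the two minimizers costs at most η each, so growth at `x₀` bounds the
  -- displacement of the minimizer by 2η.
  have h1 := quadratic_growth h hint hx₀ hs (optSol_mem hint hxX)
  have h2 := optSol_isMinOn h hint hxX (optSol_mem hint hx₀)
  have h3 := abs_le.1 (hx _ (optSol_mem hint hxX))
  have h4 := abs_le.1 (hx _ (optSol_mem hint hx₀))
  have h5 : μ / 4 * ‖optSol Θ f x - optSol Θ f x₀‖ ^ 2 ≤ μ / 4 * (ε ^ 2 / 2) := by linarith
  have h6 := le_of_mul_le_mul_left h5 (by positivity)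
  have h7 : ‖optSol Θ f x - optSol Θ f x₀‖ ^ 2 < ε ^ 2 := by nlinarith [sq_pos_of_pos hε]
  exact lt_of_pow_lt_pow_left₀ 2 hε.le h7

/-- If `f(·; x)` is bounded by `B` then its gradient is bounded at the centre of a ball in `Θ`. -/
lemma norm_gradθ_le (h : SmoothStronglyConvex Θ X f) {x : E d} (hx : x ∈ X) {B r : ℝ}
    (hB : ∀ θ ∈ Θ, |f θ x| ≤ B) (hr : 0 < r) {θ : E q} (hθ : Metric.closedBall θ r ⊆ Θ) :
    ‖gradθ Θ f θ x‖ ≤ 2 * B / r := by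
  set g := gradθ Θ f θ x with hg
  have hθΘ : θ ∈ Θ := hθ (Metric.mem_closedBall_self hr.le)
  rcases eq_or_ne g 0 with h0 | h0
  · rw [h0, norm_zero]
    have := (abs_nonneg _).trans (hB θ hθΘ)
    positivity
  · have hn : 0 < ‖g‖ := norm_pos_iff.2 h0
    -- Moving a distance r along the gradient raises `f` by at least r‖g‖, while `f` varies by at
    -- most 2B.
    have hmem : θ + (r / ‖g‖) • g ∈ Θ := hθ <| by
      rw [mem_closedBall_iff_norm, add_sub_cancel_left, norm_smul, Real.norm_of_nonneg
        (by positivity), div_mul_cancel₀ _ hn.ne']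
    have h1 := h.add_inner_le hx hθΘ hmem
    rw [add_sub_cancel_left, inner_smul_right, ← hg, real_inner_self_eq_norm_sq] at h1
    have h2 := abs_le.1 (hB _ hmem)
    have h3 := abs_le.1 (hB _ hθΘ)
    have h4 : r / ‖g‖ * ‖g‖ ^ 2 = r * ‖g‖ := by field_simp
    rw [le_div_iff₀ hr]
    linarith

/-! ### Constants that are uniform in the covariate -/

/-- Regularity of a gradient field `g` on `Θ` around its zero `θs`, with explicit constants. -/
structure RegularField (Θ : Set (E q)) (g : E q → E q) (θs : E q) (G : E q →L[ℝ] E q)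
    (H R r μ L C : ℝ) : Prop where
  convex : Convex ℝ Θ
  closed : IsClosed Θ
  norm_sub_le : ∀ θ ∈ Θ, ‖θ - θs‖ ≤ R
  ball_subset : Metric.closedBall θs r ⊆ Θ
  monotone : ∀ θ ∈ Θ, μ * ‖θ - θs‖ ^ 2 ≤ ⟪g θ, θ - θs⟫
  coercive : ∀ v, μ * ‖v‖ ^ 2 ≤ ⟪G v, v⟫
  norm_le : ‖G‖ ≤ L
  linearization : ∀ θ ∈ Θ, ‖g θ‖ ≤ H → ‖g θ - G (θ - θs)‖ ≤ C * ‖θ - θs‖ ^ 2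
  local_growth : ∀ θ, ‖θ - θs‖ ≤ r → ‖g θ‖ ≤ C * ‖θ - θs‖

/-- Near every covariate, the linear parts of the gradients are uniformly coercive and bounded. -/
lemma exists_local_constants (h : SmoothStronglyConvex Θ X f) (hint : InteriorOptimum Θ X f)
    {B K δ : ℝ} (hB : ∀ x ∈ X, ∀ θ ∈ Θ, |f θ x| ≤ B) (hK : 0 ≤ K) (hδ : 0 < δ)
    {G : E d → E q →L[ℝ] E q}
    (hG : ∀ x ∈ X, ∀ θ ∈ Θ, ‖θ - optSol Θ f x‖ ≤ δ →
      ‖gradθ Θ f θ x - G x (θ - optSol Θ f x)‖ ≤ K * ‖θ - optSol Θ f x‖ ^ 2)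
    {x₀ : E d} (hx₀ : x₀ ∈ X) :
    ∃ r c L : ℝ, 0 < r ∧ 0 < c ∧ ∀ᶠ x in 𝓝[X] x₀,
      Metric.closedBall (optSol Θ f x) r ⊆ Θ ∧ (∀ v, c * ‖v‖ ^ 2 ≤ ⟪G x v, v⟫) ∧ ‖G x‖ ≤ L := by
  obtain ⟨μ, hμ, hs⟩ := h.stronglyConvex x₀ hx₀
  obtain ⟨ρ, hρ, hball⟩ := Metric.mem_nhds_iff.1 (mem_interior_iff_mem_nhds.1 (hint x₀ hx₀))
  -- δ keeps the sphere where the linearization holds, ρ/4 leaves room for a ball of radius 2r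
  -- around the moved optimum, and the last bound makes the linearization error K r³ at most μ
  -- r²/16.
  set r : ℝ := min (min δ (ρ / 4)) (μ / (16 * (K + 1))) with hr_def
  have hr : 0 < r := by positivity
  have hrδ : r ≤ δ := (min_le_left _ _).trans (min_le_left _ _)
  have hrρ : r ≤ ρ / 4 := (min_le_left _ _).trans (min_le_right _ _)
  have hrK : K * r ≤ μ / 16 := by
    have h1 : r ≤ μ / (16 * (K + 1)) := min_le_right _ _
    rw [le_div_iff₀ (by positivity)] at h1
    nlinarith
  refine ⟨r, μ / 32, (2 * B / r + K * r ^ 2) / r, hr, by positivity, ?_⟩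
  filter_upwards [eventually_norm_optSol_sub_lt h hint hx₀ (ε := r / 10) (by positivity),
    h.eventually_abs_sub_le hx₀ (η := μ * r ^ 2 / 100) (by positivity), self_mem_nhdsWithin]
    with x hxε hxη hx
  set θs := optSol Θ f x with hθs
  set θ0 := optSol Θ f x₀ with hθ0
  have hball2 : Metric.closedBall θs (2 * r) ⊆ Θ := by
    refine subset_trans ?_ hball
    intro y hy
    rw [mem_closedBall_iff_norm] at hy
    rw [mem_ball_iff_norm]
    have : ‖y - θ0‖ ≤ ‖y - θs‖ + ‖θs - θ0‖ := by
      simpa using norm_add_le (y - θs) (θs - θ0)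
    linarith
  have hmem : ∀ v : E q, ‖v‖ = r → θs + v ∈ Θ := fun v hv => hball2 <| by
    rw [mem_closedBall_iff_norm, add_sub_cancel_left, hv]; linarith
  have hlin : ∀ v : E q, ‖v‖ = r → ‖gradθ Θ f (θs + v) x - G x v‖ ≤ K * r ^ 2 := fun v hv => by
    have := hG x hx (θs + v) (hmem v hv) (by rw [add_sub_cancel_left, hv]; exact hrδ)
    rwa [add_sub_cancel_left, hv] at this
  have hθsΘ : θs ∈ Θ := optSol_mem hint hx
  have hscale : ∀ v : E q, v ≠ 0 → ‖(r / ‖v‖) • v‖ = r := fun v hv => by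
    rw [norm_smul, Real.norm_of_nonneg (by positivity), div_mul_cancel₀ _ (norm_ne_zero_iff.2 hv)]
  refine ⟨(Metric.closedBall_subset_closedBall (by linarith)).trans hball2, ?_, ?_⟩
  -- Coercivity is tested on a sphere of fixed radius r. Growth at `x₀` transfers to `x` with an
  -- error 2η, convexity turns it into a lower bound on ⟪∇f, v⟫, and the linearization replaces ∇f
  -- by `G x`. Only the modulus μ at `x₀` enters, so the bound holds for all nearby `x`; homogeneity
  -- extends it to all v.
  · have key : ∀ v : E q, ‖v‖ = r → μ / 32 * r ^ 2 ≤ ⟪G x v, v⟫ := by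
      intro v hv
      have g1 := quadratic_growth h hint hx₀ hs (hmem v hv)
      have g2 := optSol_isMinOn h hint hx (optSol_mem hint hx₀)
      have g3 := abs_le.1 (hxη _ (hmem v hv))
      have g4 := abs_le.1 (hxη _ (optSol_mem hint hx₀))
      have g5 : 9 / 10 * r ≤ ‖θs + v - θ0‖ := by
        have : ‖v‖ ≤ ‖θs + v - θ0‖ + ‖θs - θ0‖ := by
          have := norm_sub_le (θs + v - θ0) (θs - θ0)
          rwa [show θs + v - θ0 - (θs - θ0) = v by abel] at this
        linarith
      have g6 : (9 / 10 * r) ^ 2 ≤ ‖θs + v - θ0‖ ^ 2 := by gcongr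
      have g7 := h.add_inner_le hx (hmem v hv) hθsΘ
      rw [show θs - (θs + v) = -v by abel, inner_neg_right] at g7
      have g8 : ⟪gradθ Θ f (θs + v) x - G x v, v⟫ ≤ K * r ^ 2 * r :=
        (real_inner_le_norm _ _).trans (by rw [hv]; gcongr; exact hlin v hv)
      rw [inner_sub_left] at g8
      have g9 : K * r ^ 2 * r ≤ μ / 16 * r ^ 2 := by nlinarith [sq_nonneg r]
      have g10 : μ / 4 * (9 / 10 * r) ^ 2 ≤ μ / 4 * ‖θs + v - θ0‖ ^ 2 := by gcongr
      nlinarith [mul_pos hμ (pow_pos hr 2)]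
    intro v
    rcases eq_or_ne v 0 with rfl | hv
    · simp
    · have h1 := key _ (hscale v hv)
      rw [map_smul, inner_smul_left, inner_smul_right] at h1
      have hn : 0 < ‖v‖ := norm_pos_iff.2 hv
      have h2 : (r / ‖v‖) ^ 2 * (μ / 32 * ‖v‖ ^ 2) ≤ (r / ‖v‖) ^ 2 * ⟪G x v, v⟫ := by
        calc _ = μ / 32 * r ^ 2 := by field_simp
          _ ≤ _ := h1
          _ = _ := by simp; ring
      exact le_of_mul_le_mul_left h2 (by positivity)
  · have hB0 : 0 ≤ B := (abs_nonneg _).trans (hB x hx _ hθsΘ)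
    refine ContinuousLinearMap.opNorm_le_bound _ (by positivity) fun v => ?_
    rcases eq_or_ne v 0 with rfl | hv
    · simp
    · set w := (r / ‖v‖) • v with hw
      have hwr : ‖w‖ = r := hscale v hv
      have hn : 0 < ‖v‖ := norm_pos_iff.2 hv
      -- The ball of radius r around θs + w lies in the ball of radius 2r around θs, so the gradient
      -- there is bounded, and with it `G x w`.
      have h1 : ‖gradθ Θ f (θs + w) x‖ ≤ 2 * B / r := by
        refine norm_gradθ_le h hx (hB x hx) hr (subset_trans ?_ hball2)
        refine Metric.closedBall_subset_closedBall' ?_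
        rw [dist_eq_norm, add_sub_cancel_left, hwr]; linarith
      have h2 : ‖G x w‖ ≤ 2 * B / r + K * r ^ 2 := by
        have := norm_sub_le (gradθ Θ f (θs + w) x) (gradθ Θ f (θs + w) x - G x w)
        rw [sub_sub_cancel] at this
        linarith [hlin w hwr]
      rw [hw, map_smul, norm_smul, Real.norm_of_nonneg (by positivity)] at h2
      rw [div_mul_eq_mul_div, le_div_iff₀ hr]
      rw [div_mul_eq_mul_div, div_le_iff₀ hn] at h2
      linarith

/-- The gradient fields of a smooth and strongly convex problem are regular, with constants that
do not depend on the covariate. -/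
theorem exists_regularField (h : SmoothStronglyConvex Θ X f) (hint : InteriorOptimum Θ X f)
    (hlin : LocalLinearization Θ X f) (hX : X.Nonempty) (H : ℝ) :
    ∃ R r μ L C : ℝ, 0 < R ∧ 0 < r ∧ 0 < μ ∧ 0 ≤ L ∧ 0 ≤ C ∧ ∀ x ∈ X, ∃ G : E q →L[ℝ] E q,
      RegularField Θ (fun θ => gradθ Θ f θ x) (optSol Θ f x) G H R r μ L C := by
  obtain ⟨K', δ, hδ, hG'⟩ := hlin
  choose! M _ hM using hG'
  set G : E d → E q →L[ℝ] E q := fun x => Matrix.toEuclideanCLM (𝕜 := ℝ) (M x) with hGdef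
  set K := max K' 0 with hKdef
  have hK : 0 ≤ K := le_max_right _ _
  have hG : ∀ x ∈ X, ∀ θ ∈ Θ, ‖θ - optSol Θ f x‖ ≤ δ →
      ‖gradθ Θ f θ x - G x (θ - optSol Θ f x)‖ ≤ K * ‖θ - optSol Θ f x‖ ^ 2 := by
    intro x hx θ hθ hd
    refine (hM x hx θ hθ hd).trans ?_
    gcongr
    exact le_max_left _ _
  obtain ⟨B, hB'⟩ := (h.compact_Θ.prod h.compact_X).exists_bound_of_continuousOn h.continuousOn
  have hB : ∀ x ∈ X, ∀ θ ∈ Θ, |f θ x| ≤ B := fun x hx θ hθ => hB' (θ, x) ⟨hθ, hx⟩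
  obtain ⟨r, c, L, hr, hc, hall⟩ : ∃ r c L : ℝ, 0 < r ∧ 0 < c ∧ ∀ x ∈ X,
      Metric.closedBall (optSol Θ f x) r ⊆ Θ ∧ (∀ v, c * ‖v‖ ^ 2 ≤ ⟪G x v, v⟫) ∧ ‖G x‖ ≤ L := by
    -- Local constants are merged over a finite cover by taking minima of r and c and maxima of L.
    refine h.compact_X.induction_on (p := fun s => ∃ r c L : ℝ, 0 < r ∧ 0 < c ∧ ∀ x ∈ s,
      Metric.closedBall (optSol Θ f x) r ⊆ Θ ∧ (∀ v, c * ‖v‖ ^ 2 ≤ ⟪G x v, v⟫) ∧ ‖G x‖ ≤ L)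
      ⟨1, 1, 1, one_pos, one_pos, by simp⟩ ?_ ?_ ?_
    · rintro s t hst ⟨r, c, L, hr, hc, H⟩
      exact ⟨r, c, L, hr, hc, fun x hx => H x (hst hx)⟩
    · rintro s t ⟨r, c, L, hr, hc, H⟩ ⟨r', c', L', hr', hc', H'⟩
      refine ⟨min r r', min c c', max L L', lt_min hr hr', lt_min hc hc', ?_⟩
      rintro x (hx | hx)
      · obtain ⟨h1, h2, h3⟩ := H x hx
        refine ⟨(Metric.closedBall_subset_closedBall (min_le_left _ _)).trans h1, fun v => ?_,
          h3.trans (le_max_left _ _)⟩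
        exact le_trans (by gcongr; exact min_le_left _ _) (h2 v)
      · obtain ⟨h1, h2, h3⟩ := H' x hx
        refine ⟨(Metric.closedBall_subset_closedBall (min_le_right _ _)).trans h1, fun v => ?_,
          h3.trans (le_max_right _ _)⟩
        exact le_trans (by gcongr; exact min_le_right _ _) (h2 v)
    · intro x hx
      obtain ⟨r, c, L, hr, hc, H⟩ := exists_local_constants h hint hB hK hδ hG hx
      exact ⟨_, H, r, c, L, hr, hc, fun y hy => hy⟩
  have hL : 0 ≤ L := by
    obtain ⟨x, hx⟩ := hX
    exact (norm_nonneg _).trans (hall x hx).2.2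
  obtain ⟨R', hR'⟩ := h.compact_Θ.isBounded.exists_norm_le
  set R := 2 * |R'| + 1 with hRdef
  have hR : 0 < R := by positivity
  have hsub : ∀ x ∈ X, ∀ θ ∈ Θ, ‖θ - optSol Θ f x‖ ≤ R := by
    intro x hx θ hθ
    have h1 := hR' θ hθ
    have h2 := hR' _ (optSol_mem hint hx)
    have := norm_sub_le θ (optSol Θ f x)
    have := le_abs_self R'
    linarith
  set ρ := min δ (c / (2 * (K + 1))) with hρdef
  have hρ : 0 < ρ := by positivity
  have hρK : K * ρ ≤ c / 2 := by
    have h1 : ρ ≤ c / (2 * (K + 1)) := min_le_right _ _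
    rw [le_div_iff₀ (by positivity)] at h1
    nlinarith
  set μ := min c (min (c / 2) (c / 2 * ρ / R)) with hμdef
  have hμ : 0 < μ := by positivity
  set r₁ := min r δ with hr₁
  have hr1 : 0 < r₁ := lt_min hr hδ
  -- The three summands serve the linearization within δ, the linearization beyond δ (a bounded
  -- quantity divided by δ²), and the linear growth of the gradient near the optimum.
  set C := K + (|H| + L * R) / δ ^ 2 + (L + K * r₁) with hC
  have hC1 : K ≤ C := by
    have : 0 ≤ (|H| + L * R) / δ ^ 2 := by positivity
    have : 0 ≤ L + K * r₁ := by positivity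
    linarith
  have hC2 : (|H| + L * R) / δ ^ 2 ≤ C := by
    have : 0 ≤ L + K * r₁ := by positivity
    linarith
  have hC3 : L + K * r₁ ≤ C := by
    have : 0 ≤ (|H| + L * R) / δ ^ 2 := by positivity
    linarith
  refine ⟨R, r₁, μ, L, C, hR, hr1, hμ, hL, hK.trans hC1, fun x hx => ⟨G x, ?_⟩⟩
  obtain ⟨hb, hco, hn⟩ := hall x hx
  set θs := optSol Θ f x with hθs
  have hsmall : ∀ θ ∈ Θ, ‖θ - θs‖ ≤ ρ → c / 2 * ‖θ - θs‖ ^ 2 ≤ ⟪gradθ Θ f θ x, θ - θs⟫ := by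
    intro θ hθ hd
    have h1 := hG x hx θ hθ (hd.trans (min_le_left _ _))
    have h2 := hco (θ - θs)
    have h3 : ⟪G x (θ - θs) - gradθ Θ f θ x, θ - θs⟫ ≤ K * ‖θ - θs‖ ^ 2 * ‖θ - θs‖ := by
      refine (real_inner_le_norm _ _).trans ?_
      rw [norm_sub_rev]
      gcongr
    rw [inner_sub_left] at h3
    have h4 : K * ‖θ - θs‖ ^ 2 * ‖θ - θs‖ ≤ c / 2 * ‖θ - θs‖ ^ 2 := by
      have : K * ‖θ - θs‖ ≤ c / 2 := le_trans (by gcongr) hρK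
      nlinarith [sq_nonneg ‖θ - θs‖]
    linarith
  refine ⟨h.convex_Θ, h.compact_Θ.isClosed, hsub x hx,
    (Metric.closedBall_subset_closedBall (min_le_left _ _)).trans hb, ?_, ?_, hn, ?_, ?_⟩
  · intro θ hθ
    by_cases hd : ‖θ - θs‖ ≤ ρ
    · refine le_trans ?_ (hsmall θ hθ hd)
      gcongr
      exact (min_le_right _ _).trans (min_le_left _ _)
    -- Far from the optimum, monotonicity along the segment compares θ with the point θ' at distance
    -- ρ. This yields growth linear in ‖θ - θs‖, which is quadratic after dividing by the diameter
    -- bound R.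
    · push Not at hd
      have hpos : 0 < ‖θ - θs‖ := hρ.trans hd
      set s := ρ / ‖θ - θs‖ with hs
      have hs1 : s < 1 := (div_lt_one hpos).2 hd
      have hs0 : 0 < s := by positivity
      set θ' := θs + s • (θ - θs) with hθ'
      have hθ'm : θ' ∈ Θ := h.convex_Θ.add_smul_sub_mem (optSol_mem hint hx) hθ ⟨hs0.le, hs1.le⟩
      have h1 : θ' - θs = s • (θ - θs) := by simp [hθ']
      have h2 : θ - θ' = (1 - s) • (θ - θs) := by simp only [hθ']; module
      have h3 : ‖θ' - θs‖ = ρ := by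
        rw [h1, norm_smul, Real.norm_of_nonneg hs0.le, hs, div_mul_cancel₀ _ hpos.ne']
      have h4 := hsmall θ' hθ'm h3.le
      have h5 := h.inner_grad_sub_nonneg hx hθ hθ'm
      rw [h2, inner_smul_right, inner_smul_right] at h5
      have h6 := le_of_mul_le_mul_left h5 (by linarith)
      rw [h3, h1, inner_smul_right] at h4
      have h7 : c / 2 * ρ * ‖θ - θs‖ ≤ ⟪gradθ Θ f θ' x, θ - θs⟫ := by
        have : s * (c / 2 * ρ * ‖θ - θs‖) = c / 2 * ρ ^ 2 := by rw [hs]; field_simp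
        exact le_of_mul_le_mul_left (by linarith) hs0
      refine le_trans ?_ (h7.trans h6)
      calc μ * ‖θ - θs‖ ^ 2 ≤ (c / 2 * ρ / R) * ‖θ - θs‖ ^ 2 := by
            gcongr; exact (min_le_right _ _).trans (min_le_right _ _)
        _ = c / 2 * ρ * ‖θ - θs‖ * (‖θ - θs‖ / R) := by ring
        _ ≤ c / 2 * ρ * ‖θ - θs‖ * 1 := by
            gcongr
            exact (div_le_one hR).2 (hsub x hx θ hθ)
        _ = _ := mul_one _
  · intro v
    refine le_trans ?_ (hco v)
    gcongr
    exact min_le_left _ _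
  · intro θ hθ hH
    by_cases hd : ‖θ - θs‖ ≤ δ
    · refine (hG x hx θ hθ hd).trans ?_
      gcongr
    · push Not at hd
      have h1 : ‖gradθ Θ f θ x - G x (θ - θs)‖ ≤ |H| + L * R := by
        refine (norm_sub_le _ _).trans (add_le_add (hH.trans (le_abs_self H)) ?_)
        exact ((G x).le_opNorm _).trans (by gcongr; exact hsub x hx θ hθ)
      refine h1.trans ?_
      calc |H| + L * R = (|H| + L * R) / δ ^ 2 * δ ^ 2 := by field_simp
        _ ≤ C * ‖θ - θs‖ ^ 2 := by gcongr
  · intro θ hd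
    have hθ : θ ∈ Θ := hb (by
      rw [mem_closedBall_iff_norm]; exact hd.trans (min_le_left _ _))
    have h1 := hG x hx θ hθ (hd.trans (min_le_right _ _))
    have h2 : ‖G x (θ - θs)‖ ≤ L * ‖θ - θs‖ := ((G x).le_opNorm _).trans (by gcongr)
    have h3 := norm_add_le (gradθ Θ f θ x - G x (θ - θs)) (G x (θ - θs))
    rw [sub_add_cancel] at h3
    have h4 : K * ‖θ - θs‖ ^ 2 ≤ K * r₁ * ‖θ - θs‖ := by
      rw [sq, ← mul_assoc]; gcongr
    calc _ ≤ (L + K * r₁) * ‖θ - θs‖ := by linarith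
      _ ≤ _ := by gcongr

end Problem

/-! ### The Euclidean projection -/

section Projection

variable {q : ℕ} {Θ : Set (E q)}

lemma proj_spec (hne : Θ.Nonempty) (hcl : IsClosed Θ) (y : E q) :
    proj Θ y ∈ Θ ∧ ∀ z ∈ Θ, ‖y - proj Θ y‖ ≤ ‖y - z‖ := by
  obtain ⟨p, hp, hd⟩ := hcl.exists_infDist_eq_dist hne y
  refine Classical.epsilon_spec (p := fun p => p ∈ Θ ∧ ∀ z ∈ Θ, ‖y - p‖ ≤ ‖y - z‖)
    ⟨p, hp, fun z hz => ?_⟩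
  rw [← dist_eq_norm, ← dist_eq_norm, ← hd]
  exact Metric.infDist_le_dist_of_mem hz

lemma proj_inner_le_zero (hconv : Convex ℝ Θ) (hne : Θ.Nonempty) (hcl : IsClosed Θ) (y : E q)
    {z : E q} (hz : z ∈ Θ) : ⟪y - proj Θ y, z - proj Θ y⟫ ≤ 0 := by
  obtain ⟨hp, hmin⟩ := proj_spec hne hcl y
  refine (norm_eq_iInf_iff_real_inner_le_zero hconv hp).1 ?_ z hz
  have : Nonempty Θ := ⟨⟨_, hp⟩⟩
  refine le_antisymm (le_ciInf fun w => hmin w w.2) ?_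
  exact ciInf_le (f := fun w : Θ => ‖y - w‖) ⟨0, by rintro _ ⟨w, rfl⟩; exact norm_nonneg _⟩
    ⟨_, hp⟩

/-- The sum of the variational inequalities at the two projections gives ‖p - p'‖² ≤ ⟪y - y', p -
p'⟫; Cauchy–Schwarz finishes. -/
lemma norm_proj_sub_proj_le (hconv : Convex ℝ Θ) (hne : Θ.Nonempty) (hcl : IsClosed Θ)
    (y y' : E q) : ‖proj Θ y - proj Θ y'‖ ≤ ‖y - y'‖ := by
  have h1 := proj_inner_le_zero hconv hne hcl y (proj_spec hne hcl y').1
  have h2 := proj_inner_le_zero hconv hne hcl y' (proj_spec hne hcl y).1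
  set p := proj Θ y
  set p' := proj Θ y'
  have h3 : ‖p - p'‖ ^ 2 ≤ ⟪y - y', p - p'⟫ := by
    have e : ⟪y - y', p - p'⟫ - ⟪p - p', p - p'⟫ = -⟪y - p, p' - p⟫ - ⟪y' - p', p - p'⟫ := by
      simp only [inner_sub_left, inner_sub_right]
      ring
    rw [real_inner_self_eq_norm_sq] at e
    linarith
  have h4 := real_inner_le_norm (y - y') (p - p')
  rcases (norm_nonneg (p - p')).eq_or_lt with h | h
  · rw [← h]; exact norm_nonneg _
  · refine le_of_mul_le_mul_right ?_ h
    nlinarith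

/-- Serves to show that the iterates are adapted. -/
lemma continuous_proj (hconv : Convex ℝ Θ) (hne : Θ.Nonempty) (hcl : IsClosed Θ) :
    Continuous (proj Θ) :=
  (LipschitzWith.of_dist_le_mul (K := 1) fun y y' => by
    simpa [dist_eq_norm] using norm_proj_sub_proj_le hconv hne hcl y y').continuous

lemma proj_of_mem (hne : Θ.Nonempty) (hcl : IsClosed Θ) {y : E q} (hy : y ∈ Θ) :
    proj Θ y = y := by
  have := (proj_spec hne hcl y).2 y hy
  rw [sub_self, norm_zero] at this
  exact (sub_eq_zero.1 (norm_le_zero_iff.1 this)).symm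

end Projection

/-! ### Step sizes and recursive inequalities -/

/-- The logarithmic factor `1 + log (t + 1)`. -/
def logFactor (t : ℕ) : ℝ := 1 + Real.log (t + 1)

lemma one_le_logFactor (t : ℕ) : 1 ≤ logFactor t := by
  have : 0 ≤ Real.log ((t : ℝ) + 1) := Real.log_nonneg (by linarith [t.cast_nonneg (α := ℝ)])
  unfold logFactor; linarith

lemma logFactor_pos (t : ℕ) : 0 < logFactor t := zero_lt_one.trans_le (one_le_logFactor t)

lemma logFactor_mono : Monotone logFactor := fun s t h => by
  unfold logFactor
  gcongr

lemma tendsto_logFactor : Tendsto logFactor atTop atTop := by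
  unfold logFactor
  refine tendsto_atTop_add_const_left _ _ (Real.tendsto_log_atTop.comp ?_)
  exact tendsto_atTop_add_const_right _ _ tendsto_natCast_atTop_atTop

lemma tendsto_logFactor_div : Tendsto (fun t : ℕ => logFactor t / (t + 1)) atTop (𝓝 0) := by
  have h : Tendsto (fun x : ℝ => (1 + Real.log x) / x) atTop (𝓝 0) := by
    have h1 : Tendsto (fun x : ℝ => x⁻¹) atTop (𝓝 0) := tendsto_inv_atTop_zero
    have h2 : Tendsto (fun x : ℝ => Real.log x / x) atTop (𝓝 0) :=
      Real.isLittleO_log_id_atTop.tendsto_div_nhds_zero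
    simpa [add_div] using h1.add h2
  exact h.comp (tendsto_atTop_add_const_right _ 1 (tendsto_natCast_atTop_atTop (R := ℝ)))

/-- Unlike log t / t, the comparison sequence `logFactor t / (t + 1)` is positive at every index, as
is the shifted step size, so the asymptotic order becomes a two-sided bound for all t after
adjusting the constants. -/
lemma StepSize.exists_bounds {γ : ℕ → ℝ} (hγ : StepSize γ) :
    ∃ k K : ℝ, 0 < k ∧ 0 < K ∧ ∀ t : ℕ, k * (logFactor t / (t + 1)) ≤ γ (t + 1) ∧
      γ (t + 1) ≤ K * (logFactor t / (t + 1)) := by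
  have hl : ∀ t : ℕ, 0 < logFactor t / ((t : ℝ) + 1) := fun t => by
    have := logFactor_pos t
    positivity
  have hpos : ∀ t : ℕ, 0 < γ (t + 1) := fun t => hγ.pos _ (by omega)
  have hshift : (fun t : ℕ => γ (t + 1)) =Θ[atTop]
      fun t : ℕ => Real.log ((t + 1 : ℕ) : ℝ) / ((t + 1 : ℕ) : ℝ) := by
    have := hγ.order
    exact ⟨this.1.comp_tendsto (tendsto_add_atTop_nat 1),
      this.2.comp_tendsto (tendsto_add_atTop_nat 1)⟩
  have hlog : ∀ᶠ t : ℕ in atTop, 1 ≤ Real.log ((t : ℝ) + 1) :=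
    (Real.tendsto_log_atTop.comp
      (tendsto_atTop_add_const_right _ 1 (tendsto_natCast_atTop_atTop (R := ℝ)))).eventually_ge_atTop 1
  have hΘ : (fun t : ℕ => Real.log ((t + 1 : ℕ) : ℝ) / ((t + 1 : ℕ) : ℝ)) =Θ[atTop]
      fun t : ℕ => logFactor t / ((t : ℝ) + 1) := by
    constructor
    · refine IsBigO.of_bound 1 ?_
      filter_upwards [hlog] with t ht
      rw [Real.norm_of_nonneg (by push_cast; positivity), Real.norm_of_nonneg (hl t).le, one_mul]
      unfold logFactor
      push_cast
      gcongr
      linarith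
    · refine IsBigO.of_bound 2 ?_
      filter_upwards [hlog] with t ht
      rw [Real.norm_of_nonneg (hl t).le, Real.norm_of_nonneg (by push_cast; positivity)]
      unfold logFactor
      push_cast
      rw [← mul_div_assoc]
      gcongr
      linarith
  have h := hshift.trans hΘ
  obtain ⟨K, hK, h1⟩ := bound_of_isBigO_nat_atTop h.1
  obtain ⟨k, hk, h2⟩ := bound_of_isBigO_nat_atTop h.2
  refine ⟨k⁻¹, K, inv_pos.2 hk, hK, fun t => ⟨?_, ?_⟩⟩
  · have := h2 (x := t) (hpos t).ne'
    rw [Real.norm_of_nonneg (hl t).le, Real.norm_of_nonneg (hpos t).le] at this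
    rw [inv_mul_le_iff₀ hk]
    exact this
  · have := h1 (x := t) (hl t).ne'
    rwa [Real.norm_of_nonneg (hl t).le, Real.norm_of_nonneg (hpos t).le] at this

lemma StepSize.eventually_le {γ : ℕ → ℝ} (hγ : StepSize γ) {ε : ℝ} (hε : 0 < ε) :
    ∀ᶠ t in atTop, γ (t + 1) ≤ ε := by
  obtain ⟨k, K, hk, hK, h⟩ := hγ.exists_bounds
  have := (tendsto_logFactor_div.const_mul K).eventually_le_const (u := ε) (by simpa)
  filter_upwards [this] with t ht
  exact (h t).2.trans ht

/-- This is what the logarithm in the step size buys: an arbitrarily small multiple of γ eventually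
exceeds 1/(t + 1), with no condition relating step size and curvature. -/
lemma StepSize.eventually_inv_le {γ : ℕ → ℝ} (hγ : StepSize γ) {a : ℝ} (ha : 0 < a) :
    ∀ᶠ t : ℕ in atTop, 1 / ((t : ℝ) + 1) ≤ a * γ (t + 1) := by
  obtain ⟨k, K, hk, hK, h⟩ := hγ.exists_bounds
  filter_upwards [tendsto_logFactor.eventually_ge_atTop (1 / (a * k))] with t ht
  calc 1 / ((t : ℝ) + 1) = (a * k) * (1 / (a * k) / (t + 1)) := by field_simp
    _ ≤ (a * k) * (logFactor t / (t + 1)) := by gcongr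
    _ = a * (k * (logFactor t / (t + 1))) := by ring
    _ ≤ a * γ (t + 1) := by gcongr; exact (h t).1

/-- A contracting recursion with a forcing term of logarithmic size. -/
lemma le_logFactor_of_recursion {u γ : ℕ → ℝ} {a C B : ℝ} {t₀ : ℕ} (ha : 0 < a) (hC : 0 ≤ C)
    (hγ : ∀ t ≥ t₀, 0 ≤ γ (t + 1) ∧ a * γ (t + 1) ≤ 1)
    (hu : ∀ t ≥ t₀, u (t + 1) ≤ (1 - a * γ (t + 1)) * u t + C * γ (t + 1) * logFactor t)
    (hB : ∀ t ≤ t₀, u t ≤ B) (t : ℕ) : u t ≤ (|B| + C / a) * logFactor t := by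
  have hK : 0 ≤ |B| + C / a := by positivity
  have hlow : ∀ t ≤ t₀, u t ≤ (|B| + C / a) * logFactor t := fun t ht => by
    calc u t ≤ |B| := (hB t ht).trans (le_abs_self B)
      _ ≤ |B| + C / a := le_add_of_nonneg_right (by positivity)
      _ ≤ _ := le_mul_of_one_le_right hK (one_le_logFactor t)
  rcases le_total t t₀ with h | h
  · exact hlow t h
  · induction t, h using Nat.le_induction with
    | base => exact hlow t₀ le_rfl
    | succ t ht ih =>
      obtain ⟨h0, h1⟩ := hγ t ht
      have hl := logFactor_pos t
      -- The constant is at least the equilibrium value C/a, so the forcing term is at most what the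
      -- contraction removes.
      have hCa : C ≤ a * (|B| + C / a) := by
        rw [mul_add, mul_div_cancel₀ _ ha.ne']
        have : 0 ≤ a * |B| := by positivity
        linarith
      calc u (t + 1) ≤ (1 - a * γ (t + 1)) * u t + C * γ (t + 1) * logFactor t := hu t ht
        _ ≤ (1 - a * γ (t + 1)) * ((|B| + C / a) * logFactor t)
            + (a * (|B| + C / a)) * γ (t + 1) * logFactor t := by
          gcongr
        _ = (|B| + C / a) * logFactor t := by ring
        _ ≤ _ := by
          gcongr
          exact logFactor_mono (Nat.le_succ t)

/-- A contracting recursion with a forcing term of the order of the squared step size. -/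
lemma le_logFactor_div_of_recursion {u γ : ℕ → ℝ} {a C B : ℝ} {t₀ : ℕ} (ha : 0 < a) (hC : 0 ≤ C)
    (hu0 : ∀ t, 0 ≤ u t)
    (hγ : ∀ t ≥ t₀, 1 / ((t : ℝ) + 1) ≤ a / 2 * γ (t + 1) ∧ a * γ (t + 1) ≤ 1)
    (hu : ∀ t ≥ t₀, u (t + 1) ≤ (1 - a * γ (t + 1)) * u t
      + C * γ (t + 1) * (logFactor t / (t + 1)))
    (hB : ∀ t ≤ t₀, u t ≤ B) (t : ℕ) :
    u t ≤ (|(t₀ + 1) * B| + 2 * C / (a / 2)) * (logFactor t / (t + 1)) := by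
  have hpos : ∀ t ≥ t₀, 0 ≤ γ (t + 1) := fun t ht => by
    have h1 : 0 ≤ 1 / ((t : ℝ) + 1) := by positivity
    have := h1.trans (hγ t ht).1
    exact nonneg_of_mul_nonneg_right this (by positivity)
  -- The weighted sequence (t + 1) u_t satisfies the previous recursion with rate a/2: the other
  -- half of the contraction pays for the growth factor (t + 2)/(t + 1).
  have key := le_logFactor_of_recursion (u := fun t => ((t : ℝ) + 1) * u t) (γ := γ) (a := a / 2)
    (C := 2 * C) (B := (t₀ + 1) * B) (t₀ := t₀) (by positivity) (by positivity)
    (fun t ht => ⟨hpos t ht, by nlinarith [hpos t ht, (hγ t ht).2]⟩) ?_ ?_ t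
  · rw [← mul_div_assoc, le_div_iff₀ (by positivity)]
    linarith
  · intro t ht
    obtain ⟨h1, h2⟩ := hγ t ht
    have hg := hpos t ht
    have hl := logFactor_pos t
    have hp : (0 : ℝ) < (t : ℝ) + 1 := by positivity
    have h3 : (t : ℝ) + 2 ≤ ((t : ℝ) + 1) * (1 + a / 2 * γ (t + 1)) := by
      rw [div_le_iff₀ hp] at h1; linarith
    have h4 : ((t : ℝ) + 2) * (1 - a * γ (t + 1)) ≤ (t + 1) * (1 - a / 2 * γ (t + 1)) := by
      calc _ ≤ ((t : ℝ) + 1) * (1 + a / 2 * γ (t + 1)) * (1 - a * γ (t + 1)) := by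
            gcongr
        _ ≤ _ := by
          rw [mul_assoc]
          gcongr
          nlinarith [mul_nonneg (mul_nonneg ha.le hg) (mul_nonneg ha.le hg)]
    have h5 : ((t : ℝ) + 2) / (t + 1) ≤ 2 := by
      rw [div_le_iff₀ hp]; linarith [t.cast_nonneg (α := ℝ)]
    push_cast
    calc ((t : ℝ) + 1 + 1) * u (t + 1)
        ≤ ((t : ℝ) + 2) * ((1 - a * γ (t + 1)) * u t
            + C * γ (t + 1) * (logFactor t / (t + 1))) := by
          rw [show (t : ℝ) + 1 + 1 = t + 2 by ring]
          gcongr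
          exact hu t ht
      _ = ((t : ℝ) + 2) * (1 - a * γ (t + 1)) * u t
            + ((t : ℝ) + 2) / (t + 1) * (C * γ (t + 1) * logFactor t) := by ring
      _ ≤ (t + 1) * (1 - a / 2 * γ (t + 1)) * u t + 2 * (C * γ (t + 1) * logFactor t) := by
          gcongr
          exact hu0 t
      _ = _ := by ring
  · intro t ht
    have : (t : ℝ) ≤ t₀ := by exact_mod_cast ht
    calc ((t : ℝ) + 1) * u t ≤ (t₀ + 1) * u t := by gcongr; exact hu0 t
      _ ≤ _ := by gcongr; exact hB t ht

/-- `∑_{t ≤ T} log t / t` grows at most like `(log T)²`. -/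
lemma sum_logFactor_div_le (T : ℕ) :
    ∑ t ∈ Finset.range (T + 1), logFactor t / ((t : ℝ) + 1) ≤ logFactor T ^ 2 := by
  have h1 : ∑ t ∈ Finset.range (T + 1), ((t : ℝ) + 1)⁻¹ ≤ logFactor T := by
    have := harmonic_le_one_add_log (T + 1)
    simpa [harmonic, logFactor] using this
  calc _ ≤ ∑ t ∈ Finset.range (T + 1), logFactor T * ((t : ℝ) + 1)⁻¹ := by
        refine Finset.sum_le_sum fun t ht => ?_
        rw [div_eq_mul_inv]
        gcongr
        exact logFactor_mono (by simpa [Nat.lt_succ_iff] using ht)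
    _ = logFactor T * ∑ t ∈ Finset.range (T + 1), ((t : ℝ) + 1)⁻¹ := by rw [Finset.mul_sum]
    _ ≤ logFactor T * logFactor T := by gcongr; exact (logFactor_pos T).le
    _ = _ := by ring

/-! ### A single projected stochastic gradient run -/

/-- A projected stochastic gradient run `θ` for the field `g`, with gradient estimates `gh` whose
noise is a martingale difference with conditional second moments at most `H ^ 2`. -/
structure SGDRun {q : ℕ} {Ω : Type*} {mΩ : MeasurableSpace Ω} (P : Measure Ω)
    (ℱ : Filtration ℕ mΩ) (Θ : Set (E q)) (g : E q → E q) (γ : ℕ → ℝ) (H : ℝ)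
    (θ gh : ℕ → Ω → E q) : Prop where
  mem : ∀ t ω, θ t ω ∈ Θ
  measurable : ∀ t, StronglyMeasurable[ℱ t] (θ t)
  measurable_est : ∀ t, StronglyMeasurable (gh t)
  step : ∀ t ω, θ (t + 1) ω = proj Θ (θ t ω - γ (t + 1) • gh t ω)
  memLp : ∀ t, MemLp (fun ω => gh t ω - g (θ t ω)) 2 P
  condExp_eq_zero : ∀ t, P[fun ω => gh t ω - g (θ t ω) | ℱ t] =ᵐ[P] 0
  setIntegral_le : ∀ t A, MeasurableSet[ℱ t] A →
    ∫ ω in A, ‖gh t ω - g (θ t ω)‖ ^ 2 ∂P ≤ H ^ 2 * P.real A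
  grad_le : ∀ t, ∀ᵐ ω ∂P, ‖g (θ t ω)‖ ≤ H

namespace SGDRun

variable {q : ℕ} {Ω : Type*} {mΩ : MeasurableSpace Ω} {P : Measure Ω}
  {ℱ : Filtration ℕ mΩ} {Θ : Set (E q)} {g : E q → E q} {γ : ℕ → ℝ} {H : ℝ}
  {θ gh : ℕ → Ω → E q} {θs : E q} {G : E q →L[ℝ] E q} {R r μ L C : ℝ}

lemma measurable_sub (hs : SGDRun P ℱ Θ g γ H θ gh) (t : ℕ) :
    StronglyMeasurable[ℱ t] fun ω => θ t ω - θs :=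
  (hs.measurable t).sub stronglyMeasurable_const

lemma stronglyMeasurable_sub (hs : SGDRun P ℱ Θ g γ H θ gh) (t : ℕ) :
    StronglyMeasurable fun ω => θ t ω - θs :=
  (hs.measurable_sub t).mono (ℱ.le t)

lemma integrable_sq_noise (hs : SGDRun P ℱ Θ g γ H θ gh) (t : ℕ) :
    Integrable (fun ω => ‖gh t ω - g (θ t ω)‖ ^ 2) P :=
  (hs.memLp t).integrable_norm_pow (by norm_num)

/-- No measurability of the field `g` is assumed; along the run it is the difference of the estimate
and the noise. -/
lemma aestronglyMeasurable_grad (hs : SGDRun P ℱ Θ g γ H θ gh) (t : ℕ) :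
    AEStronglyMeasurable (fun ω => g (θ t ω)) P := by
  have := (hs.measurable_est t).aestronglyMeasurable.sub (hs.memLp t).1 (μ := P)
  exact this.congr (ae_of_all _ fun ω => by simp)

variable [IsProbabilityMeasure P]

lemma memLp_sub (hs : SGDRun P ℱ Θ g γ H θ gh) (hr : RegularField Θ g θs G H R r μ L C) (t : ℕ)
    (p : ℝ≥0∞) : MemLp (fun ω => θ t ω - θs) p P :=
  MemLp.of_bound (hs.stronglyMeasurable_sub t).aestronglyMeasurable R
    (ae_of_all _ fun ω => hr.norm_sub_le _ (hs.mem t ω))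

lemma integrable_sub (hs : SGDRun P ℱ Θ g γ H θ gh) (hr : RegularField Θ g θs G H R r μ L C)
    (t : ℕ) : Integrable (fun ω => θ t ω - θs) P :=
  memLp_one_iff_integrable.1 (hs.memLp_sub hr t 1)

lemma integrable_sq_sub (hs : SGDRun P ℱ Θ g γ H θ gh) (hr : RegularField Θ g θs G H R r μ L C)
    (t : ℕ) : Integrable (fun ω => ‖θ t ω - θs‖ ^ 2) P :=
  (hs.memLp_sub hr t 2).integrable_norm_pow (by norm_num)

lemma integrable_noise (hs : SGDRun P ℱ Θ g γ H θ gh) (t : ℕ) :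
    Integrable (fun ω => gh t ω - g (θ t ω)) P :=
  (hs.memLp t).integrable (by norm_num)

lemma integral_sq_noise_le (hs : SGDRun P ℱ Θ g γ H θ gh) (t : ℕ) :
    ∫ ω, ‖gh t ω - g (θ t ω)‖ ^ 2 ∂P ≤ H ^ 2 := by
  simpa using hs.setIntegral_le t Set.univ MeasurableSet.univ

lemma integrable_inner_noise (hs : SGDRun P ℱ Θ g γ H θ gh)
    (hr : RegularField Θ g θs G H R r μ L C) (t : ℕ) :
    Integrable (fun ω => ⟪θ t ω - θs, gh t ω - g (θ t ω)⟫) P := by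
  refine ((hs.integrable_noise t).norm.const_mul R).mono'
    ((hs.stronglyMeasurable_sub t).aestronglyMeasurable.inner (hs.memLp t).1)
    (ae_of_all _ fun ω => ?_)
  refine (norm_inner_le_norm _ _).trans ?_
  gcongr
  exact hr.norm_sub_le _ (hs.mem t ω)

/-- The noise is orthogonal to everything that is known before the step. -/
lemma integral_inner_noise (hs : SGDRun P ℱ Θ g γ H θ gh)
    (hr : RegularField Θ g θs G H R r μ L C) (t : ℕ) :
    ∫ ω, ⟪θ t ω - θs, gh t ω - g (θ t ω)⟫ ∂P = 0 := by
  have h := condExp_bilin_of_stronglyMeasurable_left (μ := P) (innerSL ℝ (E := E q))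
    (hs.measurable_sub (θs := θs) t)
    (hs.integrable_inner_noise hr t) (hs.integrable_noise t)
  rw [← integral_condExp (ℱ.le t)]
  refine integral_eq_zero_of_ae ?_
  filter_upwards [h, hs.condExp_eq_zero t] with ω h1 h2
  change _ = innerSL ℝ _ _ at h1
  refine h1.trans ?_
  rw [h2]
  simp

lemma integral_smul_noise (hs : SGDRun P ℱ Θ g γ H θ gh) (t : ℕ) {W : Ω → ℝ}
    (hW : StronglyMeasurable[ℱ t] W) {B : ℝ} (hB : ∀ ω, |W ω| ≤ B) :
    ∫ ω, W ω • (gh t ω - g (θ t ω)) ∂P = 0 := by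
  have hi : Integrable (W • fun ω => gh t ω - g (θ t ω)) P :=
    (hs.integrable_noise t).bdd_smul B (hW.mono (ℱ.le t)).aestronglyMeasurable
      (ae_of_all _ hB)
  have h := condExp_smul_of_aestronglyMeasurable_left (μ := P) hW.aestronglyMeasurable hi
    (hs.integrable_noise t)
  change ∫ ω, (W • fun ω => gh t ω - g (θ t ω)) ω ∂P = 0
  rw [← integral_condExp (ℱ.le t)]
  refine integral_eq_zero_of_ae ?_
  filter_upwards [h, hs.condExp_eq_zero t] with ω h1 h2
  simp [h1, h2]

/-- One step of the mean squared error recursion. -/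
lemma integral_sq_succ_le (hs : SGDRun P ℱ Θ g γ H θ gh)
    (hr : RegularField Θ g θs G H R r μ L C) (hθs : θs ∈ Θ) (t : ℕ) (hγ : 0 ≤ γ (t + 1)) :
    ∫ ω, ‖θ (t + 1) ω - θs‖ ^ 2 ∂P ≤ (1 - 2 * μ * γ (t + 1)) * ∫ ω, ‖θ t ω - θs‖ ^ 2 ∂P
      + 4 * H ^ 2 * γ (t + 1) ^ 2 := by
  set a := γ (t + 1) with ha
  have hpt : ∀ᵐ ω ∂P, ‖θ (t + 1) ω - θs‖ ^ 2 ≤ (1 - 2 * μ * a) * ‖θ t ω - θs‖ ^ 2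
      - 2 * a * ⟪θ t ω - θs, gh t ω - g (θ t ω)⟫
      + a ^ 2 * (2 * H ^ 2 + 2 * ‖gh t ω - g (θ t ω)‖ ^ 2) := by
    filter_upwards [hs.grad_le t] with ω hg
    -- θs is its own projection, so nonexpansiveness removes the projection from the recursion.
    have h1 : ‖θ (t + 1) ω - θs‖ ≤ ‖θ t ω - θs - a • gh t ω‖ := by
      have := norm_proj_sub_proj_le hr.convex ⟨_, hθs⟩ hr.closed (θ t ω - a • gh t ω) θs
      rw [proj_of_mem ⟨_, hθs⟩ hr.closed hθs, ← hs.step] at this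
      rwa [sub_right_comm] at this
    have h2 : ‖θ (t + 1) ω - θs‖ ^ 2 ≤ ‖θ t ω - θs - a • gh t ω‖ ^ 2 := by gcongr
    rw [norm_sub_sq_real (θ t ω - θs), inner_smul_right, norm_smul, mul_pow, Real.norm_eq_abs,
      sq_abs] at h2
    have h3 := hr.monotone _ (hs.mem t ω)
    rw [real_inner_comm] at h3
    have h4 : ⟪θ t ω - θs, gh t ω⟫ = ⟪θ t ω - θs, g (θ t ω)⟫
        + ⟪θ t ω - θs, gh t ω - g (θ t ω)⟫ := by
      rw [← inner_add_right, add_sub_cancel]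
    have h5 : ‖gh t ω‖ ≤ ‖g (θ t ω)‖ + ‖gh t ω - g (θ t ω)‖ := by
      simpa using norm_add_le (g (θ t ω)) (gh t ω - g (θ t ω))
    have h6 : ‖gh t ω‖ ^ 2 ≤ 2 * H ^ 2 + 2 * ‖gh t ω - g (θ t ω)‖ ^ 2 := by
      have : ‖gh t ω‖ ^ 2 ≤ (H + ‖gh t ω - g (θ t ω)‖) ^ 2 := by gcongr; linarith
      nlinarith [sq_nonneg (H - ‖gh t ω - g (θ t ω)‖)]
    have h7 := mul_le_mul_of_nonneg_left h6 (sq_nonneg a)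
    have h8 := mul_le_mul_of_nonneg_left h3 hγ
    rw [h4] at h2
    linarith
  have i1 := (hs.integrable_sq_sub hr t).const_mul (1 - 2 * μ * a)
  have i2 : Integrable (fun ω => 2 * a * ⟪θ t ω - θs, gh t ω - g (θ t ω)⟫) P :=
    (hs.integrable_inner_noise hr t).const_mul _
  have i3 : Integrable (fun ω => a ^ 2 * (2 * H ^ 2 + 2 * ‖gh t ω - g (θ t ω)‖ ^ 2)) P :=
    ((integrable_const _).add ((hs.integrable_sq_noise t).const_mul 2)).const_mul _
  refine (integral_mono_ae (hs.integrable_sq_sub hr (t + 1)) ((i1.sub i2).add i3) hpt).trans ?_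
  have e1 : ∫ ω, ((1 - 2 * μ * a) * ‖θ t ω - θs‖ ^ 2
      - 2 * a * ⟪θ t ω - θs, gh t ω - g (θ t ω)⟫
      + a ^ 2 * (2 * H ^ 2 + 2 * ‖gh t ω - g (θ t ω)‖ ^ 2)) ∂P
      = (1 - 2 * μ * a) * ∫ ω, ‖θ t ω - θs‖ ^ 2 ∂P
        + a ^ 2 * (2 * H ^ 2 + 2 * ∫ ω, ‖gh t ω - g (θ t ω)‖ ^ 2 ∂P) := by
    have i12 : Integrable (fun ω => (1 - 2 * μ * a) * ‖θ t ω - θs‖ ^ 2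
        - 2 * a * ⟪θ t ω - θs, gh t ω - g (θ t ω)⟫) P := i1.sub i2
    rw [integral_add i12 i3, integral_sub i1 i2, integral_const_mul, integral_const_mul,
      integral_const_mul, hs.integral_inner_noise hr t,
      integral_add (integrable_const _) ((hs.integrable_sq_noise t).const_mul 2),
      integral_const]
    simp [integral_const_mul]
  refine e1.le.trans ?_
  have := mul_le_mul_of_nonneg_left (hs.integral_sq_noise_le t) (sq_nonneg a)
  linarith

/-- The correction made by the projection. -/
def correction (γ : ℕ → ℝ) (θ gh : ℕ → Ω → E q) (t : ℕ) (ω : Ω) : E q :=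
  θ (t + 1) ω - (θ t ω - γ (t + 1) • gh t ω)

lemma integrable_correction (hs : SGDRun P ℱ Θ g γ H θ gh)
    (hr : RegularField Θ g θs G H R r μ L C) (t : ℕ) :
    Integrable (correction γ θ gh t) P := by
  have hg : Integrable (fun ω => g (θ t ω)) P :=
    Integrable.of_bound (hs.aestronglyMeasurable_grad t) H (hs.grad_le t)
  have hgh : Integrable (gh t) P :=
    (hg.add (hs.integrable_noise t)).congr (ae_of_all _ fun ω => by simp)
  have := (hs.integrable_sub hr (t + 1)).sub ((hs.integrable_sub hr t).sub (hgh.smul (γ (t + 1))))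
  refine this.congr (ae_of_all _ fun ω => ?_)
  simp [correction]
  abel

/-- The projection is active only rarely: its mean effect is of second order. -/
lemma integral_correction_le (hs : SGDRun P ℱ Θ g γ H θ gh)
    (hr : RegularField Θ g θs G H R r μ L C) (hr0 : 0 < r) (t : ℕ) (hγ : 0 ≤ γ (t + 1)) :
    ∫ ω, ‖correction γ θ gh t ω‖ ∂P ≤ ((1 + 4 * H ^ 2) * (4 / r ^ 2) + 8 * H ^ 2 / r)
      * γ (t + 1) * (∫ ω, ‖θ t ω - θs‖ ^ 2 ∂P + γ (t + 1)) := by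
  set a := γ (t + 1) with ha
  set D := ∫ ω, ‖θ t ω - θs‖ ^ 2 ∂P with hD
  have hθs : θs ∈ Θ := hr.ball_subset (Metric.mem_closedBall_self hr0.le)
  have hne : Θ.Nonempty := ⟨_, hθs⟩
  -- `A` is the event that the iterate is at least r/2 from the optimum. Markov's inequality makes
  -- it rare; off `A` the projection acts only if the step itself is longer than r/2.
  set A := {ω | r ^ 2 / 4 ≤ ‖θ t ω - θs‖ ^ 2} with hA
  have hAm : MeasurableSet[ℱ t] A := by
    have : StronglyMeasurable[ℱ t] fun ω => ‖θ t ω - θs‖ ^ 2 :=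
      (hs.measurable_sub (θs := θs) t).norm.pow 2
    exact this.measurable measurableSet_Ici
  set ξ : Ω → ℝ := fun ω => ‖gh t ω - g (θ t ω)‖ ^ 2 with hξ
  have hpt : ∀ᵐ ω ∂P, ‖correction γ θ gh t ω‖ ≤
      A.indicator (fun ω => a * (1 + 2 * H ^ 2 + 2 * ξ ω)) ω
        + 2 / r * a ^ 2 * (2 * H ^ 2 + 2 * ξ ω) := by
    filter_upwards [hs.grad_le t] with ω hg
    have h5 : ‖gh t ω‖ ≤ ‖g (θ t ω)‖ + ‖gh t ω - g (θ t ω)‖ := by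
      simpa using norm_add_le (g (θ t ω)) (gh t ω - g (θ t ω))
    have h6 : ‖gh t ω‖ ^ 2 ≤ 2 * H ^ 2 + 2 * ξ ω := by
      have : ‖gh t ω‖ ^ 2 ≤ (H + ‖gh t ω - g (θ t ω)‖) ^ 2 := by gcongr; linarith
      simp only [hξ]
      nlinarith [sq_nonneg (H - ‖gh t ω - g (θ t ω)‖)]
    -- The current iterate lies in Θ, so it competes with the projection.
    have h7 : ‖correction γ θ gh t ω‖ ≤ a * ‖gh t ω‖ := by
      have := (proj_spec hne hr.closed (θ t ω - a • gh t ω)).2 _ (hs.mem t ω)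
      rw [← hs.step, sub_sub_cancel_left, norm_neg, norm_smul, Real.norm_of_nonneg hγ] at this
      rw [correction, norm_sub_rev]
      exact this
    have h8 : 0 ≤ 2 / r * a ^ 2 * (2 * H ^ 2 + 2 * ξ ω) := by
      have : 0 ≤ ξ ω := sq_nonneg _
      positivity
    by_cases hω : ω ∈ A
    · rw [Set.indicator_of_mem hω]
      have h9 : ‖gh t ω‖ ≤ 1 + ‖gh t ω‖ ^ 2 := by nlinarith [sq_nonneg (‖gh t ω‖ - 1)]
      have : a * ‖gh t ω‖ ≤ a * (1 + 2 * H ^ 2 + 2 * ξ ω) := by gcongr; linarith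
      linarith
    · rw [Set.indicator_of_notMem hω, zero_add]
      have h10 : ‖θ t ω - θs‖ < r / 2 := by
        simp only [hA, Set.mem_ofPred_eq, not_le] at hω
        refine lt_of_pow_lt_pow_left₀ 2 (by positivity) ?_
        rw [div_pow]; norm_num; exact hω
      by_cases hbig : a * ‖gh t ω‖ ≤ r / 2
      · have hin : θ t ω - a • gh t ω ∈ Θ := hr.ball_subset <| by
          rw [mem_closedBall_iff_norm, sub_right_comm]
          refine (norm_sub_le _ _).trans ?_
          rw [norm_smul, Real.norm_of_nonneg hγ]
          linarith
        have : correction γ θ gh t ω = 0 := by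
          rw [correction, hs.step, proj_of_mem hne hr.closed hin, sub_self]
        rw [this, norm_zero]
        exact h8
      · push Not at hbig
        -- A step longer than r/2 is at most 2/r times its square, which is of second order in the
        -- step size.
        calc ‖correction γ θ gh t ω‖ ≤ a * ‖gh t ω‖ := h7
          _ = 2 / r * (r / 2) * (a * ‖gh t ω‖) := by field_simp
          _ ≤ 2 / r * (a * ‖gh t ω‖) * (a * ‖gh t ω‖) := by gcongr
          _ = 2 / r * a ^ 2 * ‖gh t ω‖ ^ 2 := by ring
          _ ≤ _ := by gcongr
  have iξ : Integrable ξ P := hs.integrable_sq_noise t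
  have i1 : Integrable (fun ω => a * (1 + 2 * H ^ 2 + 2 * ξ ω)) P :=
    ((integrable_const _).add (iξ.const_mul 2)).const_mul _
  have i2 : Integrable (fun ω => 2 / r * a ^ 2 * (2 * H ^ 2 + 2 * ξ ω)) P :=
    ((integrable_const _).add (iξ.const_mul 2)).const_mul _
  have hAm' : MeasurableSet A := ℱ.le t _ hAm
  refine (integral_mono_ae (hs.integrable_correction hr t).norm ((i1.indicator hAm').add i2)
    hpt).trans ?_
  have hPA : P.real A ≤ 4 / r ^ 2 * D := by
    have h := mul_meas_ge_le_integral_of_nonneg (μ := P) (f := fun ω => ‖θ t ω - θs‖ ^ 2)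
      (ae_of_all _ fun ω => sq_nonneg _) (hs.integrable_sq_sub hr t) (r ^ 2 / 4)
    calc P.real A = 4 / r ^ 2 * (r ^ 2 / 4 * P.real A) := by field_simp
      _ ≤ _ := by gcongr
  -- Since `A` is known before the step, the conditional second-moment bound can be integrated over
  -- it, which keeps the factor P(A).
  have e1 : ∫ ω in A, a * (1 + 2 * H ^ 2 + 2 * ξ ω) ∂P ≤ a * (1 + 4 * H ^ 2) * P.real A := by
    rw [integral_const_mul, integral_add (integrable_const _) (iξ.const_mul 2).integrableOn,
      integral_const_mul]
    have := hs.setIntegral_le t A hAm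
    have h2 : ∫ _ in A, (1 + 2 * H ^ 2) ∂P = (1 + 2 * H ^ 2) * P.real A := by
      simp [mul_comm]
    rw [h2, mul_assoc]
    gcongr
    linarith
  have e2 : ∫ ω, 2 / r * a ^ 2 * (2 * H ^ 2 + 2 * ξ ω) ∂P ≤ 2 / r * a ^ 2 * (4 * H ^ 2) := by
    rw [integral_const_mul, integral_add (integrable_const _) (iξ.const_mul 2),
      integral_const]
    have := hs.integral_sq_noise_le t
    have e : ∫ ω, 2 * ξ ω ∂P = 2 * ∫ ω, ξ ω ∂P := integral_const_mul _ _
    gcongr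
    simp only [probReal_univ, one_smul]
    linarith
  have e0 : ∫ ω, (A.indicator (fun ω => a * (1 + 2 * H ^ 2 + 2 * ξ ω)) ω
      + 2 / r * a ^ 2 * (2 * H ^ 2 + 2 * ξ ω)) ∂P
      = ∫ ω in A, a * (1 + 2 * H ^ 2 + 2 * ξ ω) ∂P
        + ∫ ω, 2 / r * a ^ 2 * (2 * H ^ 2 + 2 * ξ ω) ∂P := by
    rw [integral_add (i1.indicator hAm') i2, integral_indicator hAm']
  refine e0.le.trans ((add_le_add e1 e2).trans ?_)
  have hD0 : 0 ≤ D := integral_nonneg fun ω => sq_nonneg _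
  have e3 : a * (1 + 4 * H ^ 2) * P.real A ≤ a * (1 + 4 * H ^ 2) * (4 / r ^ 2 * D) := by gcongr
  have e4 : 0 ≤ (1 + 4 * H ^ 2) * (4 / r ^ 2) * a * a := by positivity
  have e5 : 0 ≤ 8 * H ^ 2 / r * a * D := by positivity
  have e6 : ((1 + 4 * H ^ 2) * (4 / r ^ 2) + 8 * H ^ 2 / r) * a * (D + a)
      = a * (1 + 4 * H ^ 2) * (4 / r ^ 2 * D) + 2 / r * a ^ 2 * (4 * H ^ 2)
        + (1 + 4 * H ^ 2) * (4 / r ^ 2) * a * a + 8 * H ^ 2 / r * a * D := by ring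
  linarith

end SGDRun

/-! ### Correlation of the error with the past -/

/-- A small explicit gradient step on a coercive linear field is a contraction. -/
lemma RegularField.norm_sub_smul_le {q : ℕ} {Θ : Set (E q)} {g : E q → E q} {θs : E q}
    {G : E q →L[ℝ] E q} {H R r μ L C : ℝ} (hr : RegularField Θ g θs G H R r μ L C)
    {a : ℝ} (ha : 0 ≤ a) (haμ : μ * a ≤ 1) (haL : a * L ^ 2 ≤ μ) (v : E q) :
    ‖v - a • G v‖ ≤ (1 - μ / 2 * a) * ‖v‖ := by
  have h1 := hr.coercive v
  have h2 : ‖G v‖ ^ 2 ≤ (L * ‖v‖) ^ 2 := by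
    gcongr
    exact (G.le_opNorm v).trans (by gcongr; exact hr.norm_le)
  have h3 : 0 ≤ (1 - μ / 2 * a) * ‖v‖ := mul_nonneg (by linarith) (norm_nonneg _)
  refine le_of_sq_le_sq ?_ h3
  rw [norm_sub_sq_real, inner_smul_right, norm_smul, mul_pow, Real.norm_eq_abs, sq_abs,
    real_inner_comm]
  -- The second-order term uses up half of the decrease 2aμ‖v‖²; what is left, 1 - aμ, is at most (1
  -- - aμ/2)².
  have h4 : a ^ 2 * ‖G v‖ ^ 2 ≤ a * μ * ‖v‖ ^ 2 := by
    calc a ^ 2 * ‖G v‖ ^ 2 ≤ a ^ 2 * (L * ‖v‖) ^ 2 := by gcongr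
      _ = a * (a * L ^ 2) * ‖v‖ ^ 2 := by ring
      _ ≤ _ := by gcongr
  nlinarith [mul_le_mul_of_nonneg_left h1 ha, sq_nonneg (μ / 2 * a * ‖v‖)]

namespace SGDRun

variable {q : ℕ} {Ω : Type*} {mΩ : MeasurableSpace Ω} {P : Measure Ω} [IsProbabilityMeasure P]
  {ℱ : Filtration ℕ mΩ} {Θ : Set (E q)} {g : E q → E q} {γ : ℕ → ℝ} {H : ℝ}
  {θ gh : ℕ → Ω → E q} {θs : E q} {G : E q →L[ℝ] E q} {R r μ L C : ℝ}

/-- One step of the recursion for the correlation of the error with a variable that is known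
before the step. -/
lemma norm_integral_smul_succ_le (hs : SGDRun P ℱ Θ g γ H θ gh)
    (hr : RegularField Θ g θs G H R r μ L C) (hr0 : 0 < r) (hC : 0 ≤ C) (t : ℕ)
    (hγ : 0 ≤ γ (t + 1)) (hγμ : μ * γ (t + 1) ≤ 1) (hγL : γ (t + 1) * L ^ 2 ≤ μ)
    {W : Ω → ℝ} (hW : StronglyMeasurable[ℱ t] W) {B : ℝ} (hB : ∀ ω, |W ω| ≤ B) :
    ‖∫ ω, W ω • (θ (t + 1) ω - θs) ∂P‖ ≤
      (1 - μ / 2 * γ (t + 1)) * ‖∫ ω, W ω • (θ t ω - θs) ∂P‖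
      + B * (C + ((1 + 4 * H ^ 2) * (4 / r ^ 2) + 8 * H ^ 2 / r)) * γ (t + 1)
        * (∫ ω, ‖θ t ω - θs‖ ^ 2 ∂P + γ (t + 1)) := by
  have hcor := hs.integral_correction_le hr hr0 t hγ
  set a := γ (t + 1) with ha
  set D := ∫ ω, ‖θ t ω - θs‖ ^ 2 ∂P with hD
  set κ := (1 + 4 * H ^ 2) * (4 / r ^ 2) + 8 * H ^ 2 / r with hκ
  have hB0 : 0 ≤ B := by
    obtain ⟨ω⟩ : Nonempty Ω := nonempty_of_isProbabilityMeasure P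
    exact (abs_nonneg _).trans (hB ω)
  have hWm : AEStronglyMeasurable W P := (hW.mono (ℱ.le t)).aestronglyMeasurable
  have smul_int : ∀ {F : Ω → E q}, Integrable F P → Integrable (fun ω => W ω • F ω) P :=
    fun hF => hF.bdd_smul B hWm (ae_of_all _ hB)
  have smul_norm : ∀ {F : Ω → E q}, Integrable F P →
      ‖∫ ω, W ω • F ω ∂P‖ ≤ B * ∫ ω, ‖F ω‖ ∂P := fun {F} hF => by
    refine (norm_integral_le_integral_norm _).trans ?_
    rw [← integral_const_mul]
    refine integral_mono (smul_int hF).norm (hF.norm.const_mul B) fun ω => ?_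
    simp only [norm_smul, Real.norm_eq_abs]
    gcongr
    exact hB ω
  have ie := hs.integrable_sub hr t
  have iGe : Integrable (fun ω => G (θ t ω - θs)) P := G.integrable_comp ie
  have ig : Integrable (fun ω => g (θ t ω)) P :=
    Integrable.of_bound (hs.aestronglyMeasurable_grad t) H (hs.grad_le t)
  have irem : Integrable (fun ω => g (θ t ω) - G (θ t ω - θs)) P := ig.sub iGe
  have iξ := hs.integrable_noise t
  have iρ := hs.integrable_correction hr t
  -- Linear drift, linearization remainder, noise and projection correction. After integration the
  -- noise vanishes because `W` is known before the step, and `G` commutes with the integral.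
  have hdec : ∀ ω, W ω • (θ (t + 1) ω - θs) = W ω • (θ t ω - θs) - a • W ω • G (θ t ω - θs)
      - a • W ω • (g (θ t ω) - G (θ t ω - θs)) - a • W ω • (gh t ω - g (θ t ω))
      + W ω • correction γ θ gh t ω := fun ω => by
    simp only [correction, ← ha]
    module
  have hG : ∫ ω, W ω • G (θ t ω - θs) ∂P = G (∫ ω, W ω • (θ t ω - θs) ∂P) := by
    rw [← G.integral_comp_comm (smul_int ie)]
    simp
  have j1 := smul_int ie
  have j2 : Integrable (fun ω => a • W ω • G (θ t ω - θs)) P := (smul_int iGe).smul a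
  have j3 : Integrable (fun ω => a • W ω • (g (θ t ω) - G (θ t ω - θs))) P :=
    (smul_int irem).smul a
  have j4 : Integrable (fun ω => a • W ω • (gh t ω - g (θ t ω))) P := (smul_int iξ).smul a
  have j5 := smul_int iρ
  have hint : ∫ ω, W ω • (θ (t + 1) ω - θs) ∂P
      = (∫ ω, W ω • (θ t ω - θs) ∂P - a • G (∫ ω, W ω • (θ t ω - θs) ∂P))
        - a • ∫ ω, W ω • (g (θ t ω) - G (θ t ω - θs)) ∂P
        + ∫ ω, W ω • correction γ θ gh t ω ∂P := by
    have j12 : Integrable (fun ω => W ω • (θ t ω - θs) - a • W ω • G (θ t ω - θs)) P := j1.sub j2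
    have j123 : Integrable (fun ω => W ω • (θ t ω - θs) - a • W ω • G (θ t ω - θs)
        - a • W ω • (g (θ t ω) - G (θ t ω - θs))) P := j12.sub j3
    have j1234 : Integrable (fun ω => W ω • (θ t ω - θs) - a • W ω • G (θ t ω - θs)
        - a • W ω • (g (θ t ω) - G (θ t ω - θs)) - a • W ω • (gh t ω - g (θ t ω))) P :=
      j123.sub j4
    rw [integral_congr_ae (ae_of_all _ hdec), integral_add j1234 j5,
      integral_sub j123 j4, integral_sub j12 j3, integral_sub j1 j2,
      integral_smul, integral_smul, integral_smul, hs.integral_smul_noise t hW hB, hG]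
    simp
  have hrem : ∫ ω, ‖g (θ t ω) - G (θ t ω - θs)‖ ∂P ≤ C * D := by
    rw [← integral_const_mul]
    refine integral_mono_ae irem.norm ((hs.integrable_sq_sub hr t).const_mul C) ?_
    filter_upwards [hs.grad_le t] with ω hg
    exact hr.linearization _ (hs.mem t ω) hg
  rw [hint]
  refine (norm_add_le _ _).trans ((add_le_add_left (norm_sub_le _ _) _).trans ?_)
  have k1 := hr.norm_sub_smul_le hγ hγμ hγL (∫ ω, W ω • (θ t ω - θs) ∂P)
  have k2 : ‖a • ∫ ω, W ω • (g (θ t ω) - G (θ t ω - θs)) ∂P‖ ≤ a * (B * (C * D)) := by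
    rw [norm_smul, Real.norm_of_nonneg hγ]
    gcongr
    exact (smul_norm irem).trans (by gcongr)
  have k3 : ‖∫ ω, W ω • correction γ θ gh t ω ∂P‖ ≤ B * (κ * a * (D + a)) :=
    (smul_norm iρ).trans (by gcongr)
  have k4 : 0 ≤ B * C * a * a := by positivity
  have k5 : B * (C + κ) * a * (D + a) = a * (B * (C * D)) + B * (κ * a * (D + a))
      + B * C * a * a := by ring
  linarith

end SGDRun

/-! ### Moments of the summed errors -/

namespace SGDRun

variable {q : ℕ} {Ω : Type*} {mΩ : MeasurableSpace Ω} {P : Measure Ω}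
  {ℱ : Filtration ℕ mΩ} {Θ : Set (E q)} {g : E q → E q} {γ : ℕ → ℝ} {H : ℝ}
  {θ gh : ℕ → Ω → E q} {θs : E q} {G : E q →L[ℝ] E q} {R r μ L C : ℝ}

/-- The `j`-th coordinate of the sum of the first `t` errors. -/
def partialSum (θ : ℕ → Ω → E q) (θs : E q) (j : Fin q) (t : ℕ) (ω : Ω) : ℝ :=
  ∑ s ∈ Finset.range t, (θ s ω - θs) j

lemma abs_partialSum_le (hs : SGDRun P ℱ Θ g γ H θ gh) (hr : RegularField Θ g θs G H R r μ L C)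
    (j : Fin q) (t : ℕ) (ω : Ω) : |partialSum θ θs j t ω| ≤ t * R := by
  refine (Finset.abs_sum_le_sum_abs _ _).trans ?_
  refine (Finset.sum_le_card_nsmul _ _ R fun s _ => ?_).trans (by simp)
  exact (PiLp.norm_apply_le (θ s ω - θs) j).trans (hr.norm_sub_le _ (hs.mem s ω))

lemma measurable_coord (hs : SGDRun P ℱ Θ g γ H θ gh) (j : Fin q) (t : ℕ) :
    StronglyMeasurable[ℱ t] fun ω => (θ t ω - θs) j :=
  (EuclideanSpace.proj (𝕜 := ℝ) j).continuous.comp_stronglyMeasurable (hs.measurable_sub t)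

/-- The sum with index t + 1 stops at the error of time t, so it is known before the next step and
may serve as the weight `W`. -/
lemma measurable_partialSum (hs : SGDRun P ℱ Θ g γ H θ gh) (j : Fin q) (t : ℕ) :
    StronglyMeasurable[ℱ t] (partialSum θ θs j (t + 1)) := by
  refine Finset.stronglyMeasurable_fun_sum _ fun s hs' => ?_
  exact (hs.measurable_coord j s).mono (ℱ.mono (by simpa [Nat.lt_succ_iff] using hs'))

lemma stronglyMeasurable_partialSum (hs : SGDRun P ℱ Θ g γ H θ gh) (j : Fin q) (t : ℕ) :
    StronglyMeasurable (partialSum θ θs j t) :=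
  Finset.stronglyMeasurable_fun_sum _ fun s _ => (hs.measurable_coord j s).mono (ℱ.le s)

variable [IsProbabilityMeasure P]

lemma memLp_partialSum (hs : SGDRun P ℱ Θ g γ H θ gh)
    (hr : RegularField Θ g θs G H R r μ L C) (j : Fin q) (t : ℕ) (p : ℝ≥0∞) :
    MemLp (partialSum θ θs j t) p P :=
  MemLp.of_bound (hs.stronglyMeasurable_partialSum j t).aestronglyMeasurable (t * R)
    (ae_of_all _ fun ω => hs.abs_partialSum_le hr j t ω)

lemma integrable_smul_sub (hs : SGDRun P ℱ Θ g γ H θ gh)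
    (hr : RegularField Θ g θs G H R r μ L C) (j : Fin q) (t u : ℕ) :
    Integrable (fun ω => partialSum θ θs j t ω • (θ u ω - θs)) P :=
  (hs.integrable_sub hr u).bdd_smul _ (hs.stronglyMeasurable_partialSum j t).aestronglyMeasurable
    (ae_of_all _ fun ω => hs.abs_partialSum_le hr j t ω)

lemma integral_sq_sub_le (hs : SGDRun P ℱ Θ g γ H θ gh)
    (hr : RegularField Θ g θs G H R r μ L C) (t : ℕ) :
    ∫ ω, ‖θ t ω - θs‖ ^ 2 ∂P ≤ R ^ 2 := by
  refine (integral_mono (hs.integrable_sq_sub hr t) (integrable_const (R ^ 2)) fun ω => ?_).trans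
    (by simp)
  exact pow_le_pow_left₀ (norm_nonneg _) (hr.norm_sub_le _ (hs.mem t ω)) 2

lemma norm_integral_sub_le (hs : SGDRun P ℱ Θ g γ H θ gh)
    (hr : RegularField Θ g θs G H R r μ L C) (t : ℕ) : ‖∫ ω, θ t ω - θs ∂P‖ ≤ R := by
  simpa using norm_integral_le_of_norm_le_const (μ := P)
    (ae_of_all _ fun ω => hr.norm_sub_le _ (hs.mem t ω))

/-- Adding one more error changes the correlation with that error by its second moment. -/
lemma norm_integral_partialSum_succ_le (hs : SGDRun P ℱ Θ g γ H θ gh)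
    (hr : RegularField Θ g θs G H R r μ L C) (j : Fin q) (t : ℕ) :
    ‖∫ ω, partialSum θ θs j (t + 1) ω • (θ t ω - θs) ∂P‖ ≤
      ‖∫ ω, partialSum θ θs j t ω • (θ t ω - θs) ∂P‖ + ∫ ω, ‖θ t ω - θs‖ ^ 2 ∂P := by
  have i2 : Integrable (fun ω => (θ t ω - θs) j • (θ t ω - θs)) P :=
    (hs.integrable_sub hr t).bdd_smul R
      ((hs.measurable_coord j t).mono (ℱ.le t)).aestronglyMeasurable
      (ae_of_all _ fun ω => (PiLp.norm_apply_le (θ t ω - θs) j).trans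
        (hr.norm_sub_le _ (hs.mem t ω)))
  have e : ∫ ω, partialSum θ θs j (t + 1) ω • (θ t ω - θs) ∂P
      = ∫ ω, partialSum θ θs j t ω • (θ t ω - θs) ∂P
        + ∫ ω, (θ t ω - θs) j • (θ t ω - θs) ∂P := by
    rw [← integral_add (hs.integrable_smul_sub hr j t t) i2]
    simp only [partialSum, Finset.sum_range_succ, add_smul]
  rw [e]
  refine (norm_add_le _ _).trans (add_le_add_right ?_ _)
  refine (norm_integral_le_integral_norm _).trans (integral_mono i2.norm
    (hs.integrable_sq_sub hr t) fun ω => ?_)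
  simp only [norm_smul, sq]
  gcongr
  exact PiLp.norm_apply_le (θ t ω - θs) j

/-- The second moment of the sum of the errors, expanded along the run. -/
lemma integral_sq_partialSum_le (hs : SGDRun P ℱ Θ g γ H θ gh)
    (hr : RegularField Θ g θs G H R r μ L C) (j : Fin q) (t : ℕ) :
    ∫ ω, partialSum θ θs j (t + 1) ω ^ 2 ∂P ≤ ∫ ω, partialSum θ θs j t ω ^ 2 ∂P
      + 2 * ‖∫ ω, partialSum θ θs j t ω • (θ t ω - θs) ∂P‖ + ∫ ω, ‖θ t ω - θs‖ ^ 2 ∂P := by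
  have i1 : Integrable (fun ω => partialSum θ θs j t ω ^ 2) P :=
    (hs.memLp_partialSum hr j t 2).integrable_sq
  have i2 := hs.integrable_smul_sub hr j t t
  have i2' : Integrable (fun ω => partialSum θ θs j t ω * (θ t ω - θs) j) P := by
    simpa using (EuclideanSpace.proj (𝕜 := ℝ) j).integrable_comp i2
  have e : ∫ ω, partialSum θ θs j t ω * (θ t ω - θs) j ∂P
      = (∫ ω, partialSum θ θs j t ω • (θ t ω - θs) ∂P) j := by
    have := (EuclideanSpace.proj (𝕜 := ℝ) j).integral_comp_comm i2
    simpa using this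
  have i3 := hs.integrable_sq_sub hr t (θs := θs)
  have i12 : Integrable (fun ω => partialSum θ θs j t ω ^ 2
      + 2 * (partialSum θ θs j t ω * (θ t ω - θs) j)) P := i1.add (i2'.const_mul 2)
  calc ∫ ω, partialSum θ θs j (t + 1) ω ^ 2 ∂P
      ≤ ∫ ω, (partialSum θ θs j t ω ^ 2 + 2 * (partialSum θ θs j t ω * (θ t ω - θs) j)
          + ‖θ t ω - θs‖ ^ 2) ∂P := by
        refine integral_mono (hs.memLp_partialSum hr j (t + 1) 2).integrable_sq (i12.add i3)
          fun ω => ?_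
        have h1 : ((θ t ω - θs) j) ^ 2 ≤ ‖θ t ω - θs‖ ^ 2 := by
          rw [← sq_abs]
          exact pow_le_pow_left₀ (abs_nonneg _) (PiLp.norm_apply_le (θ t ω - θs) j) 2
        simp only [partialSum, Finset.sum_range_succ] at *
        nlinarith
    _ = ∫ ω, partialSum θ θs j t ω ^ 2 ∂P
          + 2 * (∫ ω, partialSum θ θs j t ω • (θ t ω - θs) ∂P) j
          + ∫ ω, ‖θ t ω - θs‖ ^ 2 ∂P := by
        rw [integral_add i12 i3, integral_add i1 (i2'.const_mul 2), integral_const_mul, e]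
    _ ≤ _ := by
        gcongr
        exact (le_abs_self _).trans
          (PiLp.norm_apply_le (∫ ω, partialSum θ θs j t ω • (θ t ω - θs) ∂P) j)

/-- Mean squared error, bias, and second moment of the summed errors of a run, with a constant that
depends on the run only through the parameters of the problem and of the step sizes. -/
theorem exists_moment_bounds (P : Measure Ω) [IsProbabilityMeasure P] (hγ : StepSize γ)
    (hR : 0 < R) (hr0 : 0 < r) (hμ : 0 < μ) (hC : 0 ≤ C) :
    ∃ K : ℝ, 0 < K ∧ ∀ {ℱ : Filtration ℕ mΩ} {Θ : Set (E q)} {g : E q → E q} {θs : E q}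
      {G : E q →L[ℝ] E q} {θ gh : ℕ → Ω → E q},
      RegularField Θ g θs G H R r μ L C → SGDRun P ℱ Θ g γ H θ gh → ∀ t : ℕ,
        ‖∫ ω, θ t ω - θs ∂P‖ ≤ K * (logFactor t / (t + 1)) ∧
        ∀ j, ∫ ω, partialSum θ θs j (t + 1) ω ^ 2 ∂P ≤ K * (t + 1) * logFactor t := by
  obtain ⟨k, K₀, hk, hK₀, hγb⟩ := hγ.exists_bounds
  have hpos : ∀ t, 0 < γ (t + 1) := fun t => hγ.pos _ (by omega)
  obtain ⟨t₀, ht₀⟩ : ∃ t₀ : ℕ, ∀ t ≥ t₀, 1 / ((t : ℝ) + 1) ≤ μ / 2 / 2 * γ (t + 1) ∧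
      μ * γ (t + 1) ≤ 1 ∧ γ (t + 1) * L ^ 2 ≤ μ := by
    -- The first condition lets μ/4 times the step size absorb 1/(t + 1); the other two are the
    -- smallness conditions for contraction.
    refine eventually_atTop.1 ?_
    filter_upwards [hγ.eventually_inv_le (a := μ / 2 / 2) (by positivity),
      hγ.eventually_le (ε := 1 / μ) (by positivity),
      hγ.eventually_le (ε := μ / (L ^ 2 + 1)) (by positivity)] with t h1 h2 h3
    refine ⟨h1, ?_, ?_⟩
    · rw [le_div_iff₀ hμ] at h2; linarith
    · rw [le_div_iff₀ (by positivity)] at h3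
      nlinarith [hpos t]
  have hl : ∀ t : ℕ, 0 < logFactor t / ((t : ℝ) + 1) := fun t => by
    have := logFactor_pos t
    positivity
  set κ := C + ((1 + 4 * H ^ 2) * (4 / r ^ 2) + 8 * H ^ 2 / r) with hκ
  have hκ0 : 0 ≤ κ := by positivity
  -- `K₁`, `K₂`, `K₃` are the constants that the recursion lemmas return for the mean square, the
  -- bias and the correlation. They are fixed before the run and its field are introduced, which
  -- gives uniformity.
  set K₁ := |((t₀ : ℝ) + 1) * R ^ 2| + 2 * (4 * H ^ 2 * K₀) / (μ / 2 / 2) with hK₁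
  have hK₁0 : 0 ≤ K₁ := by positivity
  set K₂ := |((t₀ : ℝ) + 1) * R| + 2 * (κ * (K₁ + K₀)) / (μ / 2 / 2) with hK₂
  have hK₂0 : 0 ≤ K₂ := by positivity
  set K₃ := |(t₀ : ℝ) * R * R| + (K₁ * (μ / 2 / 2) + R * κ * (K₁ + K₀)) / (μ / 2) with hK₃
  have hK₃0 : 0 ≤ K₃ := by positivity
  refine ⟨K₂ + (2 * K₃ + K₁) + 1, by positivity, ?_⟩
  intro ℱ Θ g θs G θ gh hr hs
  have hθs : θs ∈ Θ := hr.ball_subset (Metric.mem_closedBall_self hr0.le)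
  have hD : ∀ t : ℕ, ∫ ω, ‖θ t ω - θs‖ ^ 2 ∂P ≤ K₁ * (logFactor t / (t + 1)) := by
    intro t
    refine le_logFactor_div_of_recursion (u := fun t => ∫ ω, ‖θ t ω - θs‖ ^ 2 ∂P) (γ := γ)
      (a := μ / 2) (by positivity) (by positivity) (fun t => integral_nonneg fun ω => sq_nonneg _)
      (fun t ht => ⟨(ht₀ t ht).1, by nlinarith [(ht₀ t ht).2.1]⟩) (fun t ht => ?_)
      (fun t _ => hs.integral_sq_sub_le hr t) t
    have h0 : 0 ≤ ∫ ω, ‖θ t ω - θs‖ ^ 2 ∂P := integral_nonneg fun ω => sq_nonneg _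
    refine (hs.integral_sq_succ_le hr hθs t (hpos t).le).trans (add_le_add ?_ ?_)
    · refine mul_le_mul_of_nonneg_right ?_ h0
      nlinarith [mul_pos hμ (hpos t)]
    · calc 4 * H ^ 2 * γ (t + 1) ^ 2 = 4 * H ^ 2 * γ (t + 1) * γ (t + 1) := by ring
        _ ≤ 4 * H ^ 2 * γ (t + 1) * (K₀ * (logFactor t / (t + 1))) := by
          have := hpos t
          gcongr
          exact (hγb t).2
        _ = _ := by ring
  have hDγ : ∀ t : ℕ, ∫ ω, ‖θ t ω - θs‖ ^ 2 ∂P + γ (t + 1)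
      ≤ (K₁ + K₀) * (logFactor t / (t + 1)) := fun t => by
    rw [add_mul]
    exact add_le_add (hD t) (hγb t).2
  have hbias : ∀ t : ℕ, ‖∫ ω, θ t ω - θs ∂P‖ ≤ K₂ * (logFactor t / (t + 1)) := by
    intro t
    refine le_logFactor_div_of_recursion (u := fun t => ‖∫ ω, θ t ω - θs ∂P‖) (γ := γ)
      (a := μ / 2) (by positivity) (by positivity) (fun t => norm_nonneg _)
      (fun t ht => ⟨(ht₀ t ht).1, by nlinarith [(ht₀ t ht).2.1]⟩) (fun t ht => ?_)
      (fun t _ => hs.norm_integral_sub_le hr t) t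
    have h := hs.norm_integral_smul_succ_le hr hr0 hC t (hpos t).le (ht₀ t ht).2.1
      (ht₀ t ht).2.2 (W := fun _ => 1) stronglyMeasurable_const (B := 1) (by simp)
    simp only [one_smul, one_mul, ← hκ] at h
    refine h.trans (add_le_add_right ?_ _)
    calc κ * γ (t + 1) * (∫ ω, ‖θ t ω - θs‖ ^ 2 ∂P + γ (t + 1))
        ≤ κ * γ (t + 1) * ((K₁ + K₀) * (logFactor t / (t + 1))) := by
          have := hpos t
          gcongr
          exact hDγ t
      _ = _ := by ring
  have hcov : ∀ j, ∀ t : ℕ, ‖∫ ω, partialSum θ θs j t ω • (θ t ω - θs) ∂P‖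
      ≤ K₃ * logFactor t := by
    intro j t
    refine le_logFactor_of_recursion
      (u := fun t => ‖∫ ω, partialSum θ θs j t ω • (θ t ω - θs) ∂P‖) (γ := γ)
      (a := μ / 2) (t₀ := t₀) (by positivity) (by positivity)
      (fun t ht => ⟨(hpos t).le, by nlinarith [(ht₀ t ht).2.1]⟩) (fun t ht => ?_)
      (fun t ht => ?_) t
    · obtain ⟨h1, h2, h3⟩ := ht₀ t ht
      -- The weight is the sum including time t, bounded crudely by (t + 1)R. This is affordable
      -- because the perturbation carries a factor log t / (t + 1).
      have h := hs.norm_integral_smul_succ_le hr hr0 hC t (hpos t).le h2 h3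
        (hs.measurable_partialSum (θs := θs) j t) (B := ((t + 1 : ℕ) : ℝ) * R)
        (fun ω => hs.abs_partialSum_le hr j (t + 1) ω)
      simp only [← hκ] at h
      have h4 := hs.norm_integral_partialSum_succ_le hr j t
      have hg := hpos t
      have hlt := logFactor_pos t
      have h5 : 0 ≤ 1 - μ / 2 * γ (t + 1) := by nlinarith
      -- Enlarging the sum by the latest error costs its second moment, which carries 1/(t + 1) and
      -- hence counts as a forcing term proportional to γ.
      have h6 : ∫ ω, ‖θ t ω - θs‖ ^ 2 ∂P ≤ K₁ * (μ / 2 / 2) * γ (t + 1) * logFactor t := by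
        calc _ ≤ K₁ * (logFactor t / (t + 1)) := hD t
          _ = K₁ * (1 / ((t : ℝ) + 1)) * logFactor t := by ring
          _ ≤ K₁ * (μ / 2 / 2 * γ (t + 1)) * logFactor t := by gcongr
          _ = _ := by ring
      have h7 : ((t + 1 : ℕ) : ℝ) * R * κ * γ (t + 1)
          * (∫ ω, ‖θ t ω - θs‖ ^ 2 ∂P + γ (t + 1))
          ≤ R * κ * (K₁ + K₀) * γ (t + 1) * logFactor t := by
        calc _ ≤ ((t + 1 : ℕ) : ℝ) * R * κ * γ (t + 1)
            * ((K₁ + K₀) * (logFactor t / (t + 1))) := by gcongr; exact hDγ t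
          _ = _ := by push_cast; field_simp
      have h8 : 0 ≤ ∫ ω, ‖θ t ω - θs‖ ^ 2 ∂P := integral_nonneg fun ω => sq_nonneg _
      have h9 := mul_le_mul_of_nonneg_left h4 h5
      have h10 : 0 ≤ μ / 2 * γ (t + 1) * ∫ ω, ‖θ t ω - θs‖ ^ 2 ∂P := by positivity
      have h11 : (K₁ * (μ / 2 / 2) + R * κ * (K₁ + K₀)) * γ (t + 1) * logFactor t
          = K₁ * (μ / 2 / 2) * γ (t + 1) * logFactor t
            + R * κ * (K₁ + K₀) * γ (t + 1) * logFactor t := by ring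
      rw [h11]
      linarith
    · have hb : ∀ ω, ‖partialSum θ θs j t ω • (θ t ω - θs)‖ ≤ t * R * R := fun ω => by
        rw [norm_smul]
        exact mul_le_mul (hs.abs_partialSum_le hr j t ω) (hr.norm_sub_le _ (hs.mem t ω))
          (norm_nonneg _) (by positivity)
      have := norm_integral_le_of_norm_le_const (μ := P) (ae_of_all _ hb)
      rw [probReal_univ, mul_one] at this
      refine this.trans ?_
      gcongr
  intro t
  refine ⟨(hbias t).trans ?_, fun j => ?_⟩
  · exact mul_le_mul_of_nonneg_right (by linarith) (hl t).le
  · have hind : ∫ ω, partialSum θ θs j (t + 1) ω ^ 2 ∂P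
        ≤ (2 * K₃ + K₁) * ((t : ℝ) + 1) * logFactor t := by
      have step : ∀ t : ℕ, ∫ ω, partialSum θ θs j (t + 1) ω ^ 2 ∂P
          ≤ ∫ ω, partialSum θ θs j t ω ^ 2 ∂P + (2 * K₃ + K₁) * logFactor t := fun t => by
        have h1 := hs.integral_sq_partialSum_le hr j t
        have h2 := hcov j t
        have h3 : K₁ * (logFactor t / (t + 1)) ≤ K₁ * logFactor t := by
          gcongr
          exact div_le_self (logFactor_pos t).le (by linarith [t.cast_nonneg (α := ℝ)])
        have h4 := hD t
        linarith
      induction t with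
      | zero =>
        have := step 0
        simpa [partialSum] using this
      | succ t ih =>
        refine (step (t + 1)).trans ?_
        have h1 := logFactor_mono (Nat.le_succ t)
        have h2 : (2 * K₃ + K₁) * ((t : ℝ) + 1) * logFactor t
            ≤ (2 * K₃ + K₁) * ((t : ℝ) + 1) * logFactor (t + 1) := by
          gcongr
        push_cast
        linarith
    refine hind.trans ?_
    have := logFactor_pos t
    exact mul_le_mul_of_nonneg_right (mul_le_mul_of_nonneg_right (by linarith) (by positivity))
      this.le

end SGDRun

/-! ### The runs at the design points -/

section Runs

variable {q d : ℕ} {Ω : Type*} {mΩ : MeasurableSpace Ω} {P : Measure Ω} [IsProbabilityMeasure P]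
  {ℱ : Filtration ℕ mΩ} {Θ : Set (E q)} {f : E q → E d → ℝ} {x : E d} {γ : ℕ → ℝ}
  {θ₀ : E q} {ghat : ℕ → E q → Ω → E q} {K₂ R' : ℝ}

lemma sgdIter_mem (hne : Θ.Nonempty) (hcl : IsClosed Θ) (hθ₀ : θ₀ ∈ Θ) (t : ℕ) (ω : Ω) :
    sgdIter Θ γ θ₀ ghat t ω ∈ Θ := by
  cases t with
  | zero => exact hθ₀
  | succ t => exact (proj_spec hne hcl _).1

/-- Projected SGD under the martingale noise assumption is an instance of `SGDRun`. -/
lemma MartingaleNoise.sgdRun (h : MartingaleNoise P ℱ Θ f x γ θ₀ ghat K₂) (hconv : Convex ℝ Θ)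
    (hcl : IsClosed Θ) (hθ₀ : θ₀ ∈ Θ) (hR' : ∀ θ ∈ Θ, ‖θ‖ ≤ R') :
    SGDRun P ℱ Θ (fun θ => gradθ Θ f θ x) γ (√(|K₂| * (1 + R' ^ 2)))
      (sgdIter Θ γ θ₀ ghat) (fun t ω => ghat (t + 1) (sgdIter Θ γ θ₀ ghat t ω) ω) := by
  have hne : Θ.Nonempty := ⟨_, hθ₀⟩
  have hmem : ∀ t ω, sgdIter Θ γ θ₀ ghat t ω ∈ Θ := sgdIter_mem hne hcl hθ₀
  -- The noise hypothesis bounds both the conditional variance and the squared gradient by this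
  -- number. The absolute value is there because the sign of `K₂` is not given.
  have hH : √(|K₂| * (1 + R' ^ 2)) ^ 2 = |K₂| * (1 + R' ^ 2) := Real.sq_sqrt (by positivity)
  have hK : ∀ t ω, K₂ * (1 + ‖sgdIter Θ γ θ₀ ghat t ω‖ ^ 2) ≤ |K₂| * (1 + R' ^ 2) := fun t ω => by
    have h1 := pow_le_pow_left₀ (norm_nonneg _) (hR' _ (hmem t ω)) 2
    have h2 := le_abs_self K₂
    gcongr
  refine ⟨hmem, fun t => ?_, fun t => (h.adapted t).mono (ℱ.le _), fun t ω => rfl, h.memLp,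
    h.condExp_eq_zero, fun t A hA => ?_, fun t => ?_⟩
  · induction t with
    | zero => exact stronglyMeasurable_const
    | succ t ih =>
      exact (continuous_proj hconv hne hcl).comp_stronglyMeasurable
        ((ih.mono (ℱ.mono (Nat.le_succ t))).sub ((h.adapted t).const_smul (γ (t + 1))))
  · have hi : Integrable (fun ω => ‖noise Θ f x γ θ₀ ghat t ω‖ ^ 2) P :=
      (h.memLp t).integrable_norm_pow (by norm_num)
    have := setIntegral_condExp (ℱ.le t) hi hA
    change ∫ ω in A, ‖noise Θ f x γ θ₀ ghat t ω‖ ^ 2 ∂P ≤ _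
    rw [← this, hH]
    refine (setIntegral_mono_ae integrable_condExp.integrableOn
      (integrable_const (|K₂| * (1 + R' ^ 2))).integrableOn ?_).trans (by simp [mul_comm])
    filter_upwards [h.condExp_sq_le t] with ω hω
    have := hK t ω
    have := sq_nonneg ‖gradθ Θ f (sgdIter Θ γ θ₀ ghat t ω) x‖
    linarith
  · have h0 := condExp_nonneg (m := ℱ t) (μ := P)
      (f := fun ω => ‖noise Θ f x γ θ₀ ghat t ω‖ ^ 2) (ae_of_all _ fun ω => sq_nonneg _)
    filter_upwards [h.condExp_sq_le t, h0] with ω hω h0ω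
    refine Real.le_sqrt_of_sq_le ?_
    have := hK t ω
    simp only [Pi.zero_apply] at h0ω
    linarith

lemma prAverage_sub_apply (θs : E q) (j : Fin q) (T : ℕ) (ω : Ω) :
    prAverage Θ γ θ₀ ghat T ω j - θs j
      = ((T : ℝ) + 1)⁻¹ * SGDRun.partialSum (sgdIter Θ γ θ₀ ghat) θs j (T + 1) ω := by
  have h : ((T : ℝ) + 1) ≠ 0 := by positivity
  simp only [prAverage, SGDRun.partialSum, PiLp.smul_apply, WithLp.ofLp_sum, Finset.sum_apply,
    PiLp.sub_apply, Finset.sum_sub_distrib, smul_eq_mul]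
  simp
  field_simp

end Runs

/-- Bias and second moment of the averaged solutions, uniformly over the design. -/
theorem exists_average_bounds {q d : ℕ} {Θ : Set (E q)} {X : Set (E d)} {f : E q → E d → ℝ}
    (hsmooth : SmoothStronglyConvex Θ X f) (hint : InteriorOptimum Θ X f)
    (hlin : LocalLinearization Θ X f) (hX : X.Nonempty)
    {γ : ℕ → ℝ} (hγ : StepSize γ)
    {Ω : Type*} [mΩ : MeasurableSpace Ω] (P : Measure Ω) [IsProbabilityMeasure P] (K₂ : ℝ) :
    ∃ K R : ℝ, 0 < K ∧ ∀ (y : E d) (ℱ : Filtration ℕ mΩ) (θ₀ : E q) (ghat : ℕ → E q → Ω → E q),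
      y ∈ X → θ₀ ∈ Θ → MartingaleNoise P ℱ Θ f y γ θ₀ ghat K₂ → ∀ (T : ℕ) (j : Fin q),
      StronglyMeasurable[⨆ t, ℱ t] (fun ω => prAverage Θ γ θ₀ ghat T ω j - optSol Θ f y j) ∧
      (∀ ω, |prAverage Θ γ θ₀ ghat T ω j - optSol Θ f y j| ≤ R) ∧
      |∫ ω, prAverage Θ γ θ₀ ghat T ω j - optSol Θ f y j ∂P| ≤ K * (logFactor T ^ 2 / (T + 1)) ∧
      ∫ ω, (prAverage Θ γ θ₀ ghat T ω j - optSol Θ f y j) ^ 2 ∂P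
        ≤ K * (logFactor T / (T + 1)) := by
  obtain ⟨R', hR'⟩ := hsmooth.compact_Θ.isBounded.exists_norm_le
  obtain ⟨R, r, μ, L, C, hR, hr, hμ, -, hC, hreg⟩ :=
    exists_regularField hsmooth hint hlin hX (√(|K₂| * (1 + R' ^ 2)))
  obtain ⟨K, hK, hb⟩ := SGDRun.exists_moment_bounds (q := q) (H := √(|K₂| * (1 + R' ^ 2)))
    (L := L) P hγ hR hr hμ hC
  refine ⟨K, R, hK, ?_⟩
  intro y ℱ θ₀ ghat hy hθ₀ hn T j
  obtain ⟨G, hG⟩ := hreg y hy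
  have hs := hn.sgdRun hsmooth.convex_Θ hsmooth.compact_Θ.isClosed hθ₀ hR'
  have hbT := hb hG hs
  have hT : (0 : ℝ) < (T : ℝ) + 1 := by positivity
  simp only [prAverage_sub_apply]
  refine ⟨?_, fun ω => ?_, ?_, ?_⟩
  -- Measurability is recorded for the σ-algebra generated by the whole run, since independence of
  -- the runs is stated for these σ-algebras.
  · exact ((hs.measurable_partialSum j T).mono (le_iSup (fun t => (ℱ t : MeasurableSpace Ω)) T))
      |>.const_mul _
  · rw [abs_mul, abs_of_pos (inv_pos.2 hT), inv_mul_le_iff₀ hT]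
    simpa using hs.abs_partialSum_le hG j (T + 1) ω
  · rw [integral_const_mul, abs_mul, abs_of_pos (inv_pos.2 hT), inv_mul_le_iff₀ hT]
    have hi : ∀ t, Integrable (fun ω => (sgdIter Θ γ θ₀ ghat t ω - optSol Θ f y) j) P :=
      fun t => (EuclideanSpace.proj (𝕜 := ℝ) j).integrable_comp (hs.integrable_sub hG t)
    have he : ∀ t, |∫ ω, (sgdIter Θ γ θ₀ ghat t ω - optSol Θ f y) j ∂P|
        ≤ K * (logFactor t / (t + 1)) := fun t => by
      have h1 := (EuclideanSpace.proj (𝕜 := ℝ) j).integral_comp_comm (hs.integrable_sub hG t)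
      have h2 : ∫ ω, (sgdIter Θ γ θ₀ ghat t ω - optSol Θ f y) j ∂P
          = (∫ ω, sgdIter Θ γ θ₀ ghat t ω - optSol Θ f y ∂P) j := h1
      rw [h2]
      exact (PiLp.norm_apply_le (∫ ω, sgdIter Θ γ θ₀ ghat t ω - optSol Θ f y ∂P) j).trans
        (hbT t).1
    calc |∫ ω, SGDRun.partialSum (sgdIter Θ γ θ₀ ghat) (optSol Θ f y) j (T + 1) ω ∂P|
        = |∑ t ∈ Finset.range (T + 1),
            ∫ ω, (sgdIter Θ γ θ₀ ghat t ω - optSol Θ f y) j ∂P| := by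
          rw [← integral_finsetSum _ fun t _ => hi t]; rfl
      _ ≤ ∑ t ∈ Finset.range (T + 1), K * (logFactor t / (t + 1)) :=
          (Finset.abs_sum_le_sum_abs _ _).trans (Finset.sum_le_sum fun t _ => he t)
      _ = K * ∑ t ∈ Finset.range (T + 1), logFactor t / ((t : ℝ) + 1) := by rw [Finset.mul_sum]
      _ ≤ K * logFactor T ^ 2 := by gcongr; exact sum_logFactor_div_le T
      _ = _ := by field_simp
  · simp only [mul_pow]
    rw [integral_const_mul]
    calc _ ≤ (((T : ℝ) + 1)⁻¹) ^ 2 * (K * (T + 1) * logFactor T) := by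
          gcongr; exact (hbT T).2 j
      _ = _ := by field_simp

/-! ### Linear regression -/

section Regression

variable {q d s n : ℕ}

/-- The weight of the `i`-th response in the linear-regression prediction at `x`. -/
def lrWeight (φ : E d → Fin s → ℝ) (pts : Fin n → E d) (x : E d) (i : Fin n) : ℝ :=
  (φ x) ⬝ᵥ (((designMatrix φ pts).transpose * designMatrix φ pts)⁻¹.mulVec (φ (pts i)))

lemma lrPredict_apply (φ : E d → Fin s → ℝ) (pts : Fin n → E d) (Y : Fin n → E q) (x : E d)
    (j : Fin q) : lrPredict φ pts Y x j = ∑ i, lrWeight φ pts x i * Y i j := by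
  simp only [lrPredict, lsCoef, lrWeight, Matrix.mulVec, dotProduct, Matrix.transpose_apply,
    Matrix.mul_apply, Matrix.of_apply, designMatrix, Finset.sum_mul, Finset.mul_sum]
  rw [Finset.sum_comm]
  refine Finset.sum_congr rfl fun i _ => Finset.sum_congr rfl fun l _ =>
    Finset.sum_congr rfl fun k _ => ?_
  ring

/-- The regression weights reproduce the basis functions. -/
lemma sum_lrWeight_mul {φ : E d → Fin s → ℝ} {pts : Fin n → E d} (h : Identifiable φ pts)
    (x : E d) (l : Fin s) : ∑ i, lrWeight φ pts x i * φ (pts i) l = φ x l := by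
  set M := (designMatrix φ pts).transpose * designMatrix φ pts with hM
  have hdet : IsUnit M.det := (Matrix.isUnit_iff_isUnit_det M).1 h
  have h1 : M⁻¹ * M = 1 := Matrix.nonsing_inv_mul M hdet
  have h2 : ∀ k, ∑ i, (M⁻¹.mulVec (φ (pts i))) k * φ (pts i) l = (1 : Matrix (Fin s) (Fin s) ℝ) k l := by
    intro k
    rw [← h1, Matrix.mul_apply]
    simp only [Matrix.mulVec, dotProduct, Finset.sum_mul]
    rw [Finset.sum_comm]
    refine Finset.sum_congr rfl fun m _ => ?_
    rw [hM, Matrix.mul_apply, Finset.mul_sum]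
    refine Finset.sum_congr rfl fun i _ => ?_
    simp [designMatrix, mul_assoc]
  simp only [lrWeight, dotProduct, Finset.sum_mul, ← hM]
  rw [Finset.sum_comm]
  have h3 : ∀ k, ∑ i, φ x k * (M⁻¹.mulVec (φ (pts i))) k * φ (pts i) l
      = φ x k * (1 : Matrix (Fin s) (Fin s) ℝ) k l := fun k => by
    rw [← h2 k, Finset.mul_sum]
    exact Finset.sum_congr rfl fun i _ => by ring
  rw [Finset.sum_congr rfl fun k _ => h3 k]
  simp [Matrix.one_apply]

/-- For a correctly specified basis, the prediction error is a weighted sum of the errors at the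
design points. -/
lemma lrPredict_sub_optSol {Θ : Set (E q)} {X : Set (E d)} {f : E q → E d → ℝ}
    {φ : E d → Fin s → ℝ} (hspec : CorrectlySpecified Θ X f φ) {pts : Fin n → E d}
    (hpts : ∀ i, pts i ∈ X) (h : Identifiable φ pts) (Y : Fin n → E q) {x : E d} (hx : x ∈ X)
    (j : Fin q) : lrPredict φ pts Y x j - optSol Θ f x j
      = ∑ i, lrWeight φ pts x i * (Y i j - optSol Θ f (pts i) j) := by
  obtain ⟨β, hβ⟩ := hspec
  have e : ∑ i, lrWeight φ pts x i * optSol Θ f (pts i) j = optSol Θ f x j := by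
    rw [hβ x hx]
    simp only [hβ _ (hpts _), Finset.mul_sum]
    rw [Finset.sum_comm]
    refine Finset.sum_congr rfl fun l _ => ?_
    rw [← sum_lrWeight_mul h x l, Finset.mul_sum]
    exact Finset.sum_congr rfl fun i _ => by ring
  rw [lrPredict_apply, ← e]
  simp only [mul_sub, Finset.sum_sub_distrib]

/-- The regression weights are of the order `1/n`. -/
lemma exists_lrWeight_bound {X : Set (E d)} {φ : E d → Fin s → ℝ} (hφ : BoundedBasis X φ)
    {pts : (n : ℕ) → Fin n → E d} (hpts : ∀ n i, pts n i ∈ X) (hwell : WellConditioned φ pts)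
    {x : E d} (hx : x ∈ X) :
    ∃ c : ℝ, 0 ≤ c ∧ ∀ n i, |lrWeight φ (pts n) x i| ≤ c / n := by
  obtain ⟨B, hB⟩ := hφ
  obtain ⟨κ, hκ⟩ := hwell
  obtain ⟨N, hN⟩ := eventually_atTop.1 hκ
  set w : ℕ → ℝ := fun n => ∑ i, (n : ℝ) * |lrWeight φ (pts n) x i| with hw
  have hw0 : ∀ n, 0 ≤ w n := fun n => Finset.sum_nonneg fun i _ => by positivity
  set b : ℝ := √s * |B| with hb
  have hφn : ∀ y ∈ X, ‖(WithLp.toLp 2 (φ y) : E s)‖ ≤ b := fun y hy => by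
    rw [EuclideanSpace.norm_eq, hb, ← Real.sqrt_sq (abs_nonneg B), ← Real.sqrt_mul (by positivity)]
    refine Real.sqrt_le_sqrt ?_
    refine (Finset.sum_le_card_nsmul _ _ (|B| ^ 2) fun l _ => ?_).trans (by simp)
    exact pow_le_pow_left₀ (norm_nonneg _) ((hB y hy l).trans (le_abs_self B)) 2
  have hlarge : ∀ n ≥ N, ∀ i, (n : ℝ) * |lrWeight φ (pts n) x i| ≤ |κ| * b * b := by
    intro n hn i
    obtain ⟨hid, hκn⟩ := hN n hn
    have hn0 : (n : ℝ) ≠ 0 := by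
      have := i.pos
      positivity
    set M := (designMatrix φ (pts n)).transpose * designMatrix φ (pts n) with hM
    have hdet : IsUnit M.det := (Matrix.isUnit_iff_isUnit_det M).1 hid
    -- n times a weight is the bilinear form of the inverse of A_n at two bounded basis vectors.
    have hinv : ((n : ℝ)⁻¹ • M)⁻¹ = (n : ℝ) • M⁻¹ := by
      refine Matrix.inv_eq_right_inv ?_
      rw [Matrix.smul_mul, Matrix.mul_smul, smul_smul, inv_mul_cancel₀ hn0, one_smul,
        Matrix.mul_nonsing_inv M hdet]
    rw [hinv] at hκn
    set T := Matrix.toEuclideanCLM (𝕜 := ℝ) ((n : ℝ) • M⁻¹) with hT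
    have e : (n : ℝ) * lrWeight φ (pts n) x i
        = ⟪(WithLp.toLp 2 (φ x) : E s), T (WithLp.toLp 2 (φ (pts n i)))⟫ := by
      rw [hT, Matrix.toEuclideanCLM_toLp, EuclideanSpace.inner_toLp_toLp, lrWeight, ← hM,
        Matrix.smul_mulVec]
      simp [dotProduct_comm]
    rw [← abs_of_nonneg (n.cast_nonneg (α := ℝ)), ← abs_mul, e]
    refine (abs_real_inner_le_norm _ _).trans ?_
    have h1 := T.le_opNorm (WithLp.toLp 2 (φ (pts n i)))
    have h2 := hφn _ (hpts n i)
    have h3 := hκn.trans (le_abs_self κ)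
    calc _ ≤ b * (|κ| * b) := by
          gcongr
          · exact hφn x hx
          · exact h1.trans (by gcongr)
      _ = _ := by ring
  -- The finitely many small n are absorbed into the constant. The bound must hold for every n,
  -- since n may stay bounded along an optimal allocation.
  refine ⟨|κ| * b * b + ∑ n ∈ Finset.range N, w n,
    add_nonneg (by positivity) (Finset.sum_nonneg fun n _ => hw0 n), fun n i => ?_⟩
  have hn0 : (0 : ℝ) < n := by exact_mod_cast i.pos
  rw [le_div_iff₀ hn0, mul_comm]
  by_cases hn : N ≤ n
  · exact (hlarge n hn i).trans (le_add_of_nonneg_right (Finset.sum_nonneg fun n _ => hw0 n))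
  · push Not at hn
    have h1 : (n : ℝ) * |lrWeight φ (pts n) x i| ≤ w n :=
      Finset.single_le_sum (f := fun i => (n : ℝ) * |lrWeight φ (pts n) x i|)
        (fun i _ => by positivity) (Finset.mem_univ i)
    have h2 : w n ≤ ∑ n ∈ Finset.range N, w n :=
      Finset.single_le_sum (fun n _ => hw0 n) (Finset.mem_range.2 hn)
    have h3 : 0 ≤ |κ| * b * b := by positivity
    linarith

end Regression

/-- Mean square of a weighted sum of independent variables with weights of the order `1/n`. -/
lemma integral_sq_weighted_sum_le {Ω : Type*} {mΩ : MeasurableSpace Ω} {P : Measure Ω}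
    [IsProbabilityMeasure P] {n : ℕ} {Z : Fin n → Ω → ℝ} {w : Fin n → ℝ} {c b v : ℝ} (_hv : 0 ≤ v)
    (hc : 0 ≤ c) (hZ : ∀ i, MemLp (Z i) 2 P) (hind : Pairwise fun i k => IndepFun (Z i) (Z k) P)
    (hw : ∀ i, |w i| ≤ c / n) (hb : ∀ i, |∫ ω, Z i ω ∂P| ≤ b)
    (hsq : ∀ i, ∫ ω, Z i ω ^ 2 ∂P ≤ v) :
    ∫ ω, (∑ i, w i * Z i ω) ^ 2 ∂P ≤ c ^ 2 * (b ^ 2 + v / n) := by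
  have hprod : ∀ i k, Integrable (fun ω => Z i ω * Z k ω) P := fun i k =>
    (hZ i).integrable_mul (hZ k)
  -- Off the diagonal only the product of two biases survives. There are n² such terms with weights
  -- of order 1/n², so averaging does not reduce b²; the n diagonal terms contribute v/n.
  have hcov : ∀ i k, |∫ ω, Z i ω * Z k ω ∂P| ≤ b ^ 2 + if i = k then v else 0 := by
    intro i k
    by_cases hik : i = k
    · subst hik
      rw [if_pos rfl, abs_of_nonneg (integral_nonneg fun ω => mul_self_nonneg _)]
      have := hsq i
      simp only [sq] at this
      have := sq_nonneg b
      linarith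
    · rw [if_neg hik, add_zero, (hind hik).integral_fun_mul_eq_mul_integral (hZ i).1 (hZ k).1,
        abs_mul, sq]
      exact mul_le_mul (hb i) (hb k) (abs_nonneg _) ((abs_nonneg _).trans (hb i))
  have hexp : ∀ ω, (∑ i, w i * Z i ω) ^ 2 = ∑ i, ∑ k, w i * w k * (Z i ω * Z k ω) := fun ω => by
    rw [sq, Finset.sum_mul_sum]
    exact Finset.sum_congr rfl fun i _ => Finset.sum_congr rfl fun k _ => by ring
  simp only [hexp]
  rw [integral_finsetSum _ fun i _ => integrable_finsetSum _ fun k _ => (hprod i k).const_mul _]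
  have hterm : ∀ i k : Fin n, w i * w k * ∫ ω, Z i ω * Z k ω ∂P
      ≤ c / n * (c / n) * (b ^ 2 + if i = k then v else 0) := fun i k => by
    refine (le_abs_self _).trans ?_
    rw [abs_mul, abs_mul]
    have := hw i
    have := hw k
    have := hcov i k
    gcongr
  calc ∑ i, ∫ ω, ∑ k, w i * w k * (Z i ω * Z k ω) ∂P
      = ∑ i, ∑ k, w i * w k * ∫ ω, Z i ω * Z k ω ∂P := by
        refine Finset.sum_congr rfl fun i _ => ?_
        rw [integral_finsetSum _ fun k _ => (hprod i k).const_mul _]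
        exact Finset.sum_congr rfl fun k _ => integral_const_mul _ _
    _ ≤ ∑ i : Fin n, ∑ k : Fin n, c / n * (c / n) * (b ^ 2 + if i = k then v else 0) :=
        Finset.sum_le_sum fun i _ => Finset.sum_le_sum fun k _ => hterm i k
    _ = n * (c / n * (c / n) * (n * b ^ 2 + v)) := by
        simp only [← Finset.mul_sum, Finset.sum_add_distrib, Finset.sum_ite_eq, Finset.mem_univ,
          if_true, Finset.sum_const, Finset.card_univ, Fintype.card_fin, nsmul_eq_mul]
        ring
    _ ≤ c ^ 2 * (b ^ 2 + v / n) := by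
        rcases Nat.eq_zero_or_pos n with rfl | hn
        · simp; positivity
        · have : (n : ℝ) ≠ 0 := by positivity
          apply le_of_eq
          field_simp

/-! ### Mean squared error of the predictor -/

lemma otpPredict_sub_optSol {q d s : ℕ} {Ω : Type*} {Θ : Set (E q)} {X : Set (E d)}
    {f : E q → E d → ℝ} {γ : ℕ → ℝ} {θ₀ : E d → E q} {pts : (n : ℕ) → Fin n → E d}
    {ghat : (n : ℕ) → Fin n → ℕ → E q → Ω → E q} {φ : E d → Fin s → ℝ}
    (hspec : CorrectlySpecified Θ X f φ) (hpts : ∀ n i, pts n i ∈ X) {n : ℕ}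
    (hid : Identifiable φ (pts n)) (T : ℕ) {x : E d} (hx : x ∈ X) (ω : Ω) (j : Fin q) :
    otpPredict Θ γ θ₀ pts ghat φ n T x ω j - optSol Θ f x j
      = ∑ i, lrWeight φ (pts n) x i * (prAverage Θ γ (θ₀ (pts n i)) (ghat n i) T ω j
          - optSol Θ f (pts n i) j) :=
  lrPredict_sub_optSol hspec (hpts n) hid _ hx j

/-- The mean squared error of the predictor, for every identifiable design. -/
theorem exists_mse_bound {q d s : ℕ} {Θ : Set (E q)} {X : Set (E d)} {f : E q → E d → ℝ}
    (hsmooth : SmoothStronglyConvex Θ X f) (hint : InteriorOptimum Θ X f)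
    (hlin : LocalLinearization Θ X f)
    {pts : (n : ℕ) → Fin n → E d} (hpts : ∀ n i, pts n i ∈ X) {γ : ℕ → ℝ} (hγ : StepSize γ)
    {θ₀ : E d → E q} (hθ₀ : ∀ x ∈ X, θ₀ x ∈ Θ)
    {Ω : Type*} [mΩ : MeasurableSpace Ω] (P : Measure Ω) [IsProbabilityMeasure P]
    {ghat : (n : ℕ) → Fin n → ℕ → E q → Ω → E q} {ℱ : (n : ℕ) → Fin n → Filtration ℕ mΩ}
    {K₂ : ℝ} (hnoise : ∀ n i,
      MartingaleNoise P (ℱ n i) Θ f (pts n i) γ (θ₀ (pts n i)) (ghat n i) K₂)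
    (hindep : ∀ n, iIndep (fun i => ⨆ t, (ℱ n i t : MeasurableSpace Ω)) P)
    {φ : E d → Fin s → ℝ} (hφ : BoundedBasis X φ) (hwell : WellConditioned φ pts)
    (hspec : CorrectlySpecified Θ X f φ) {x : E d} (hx : x ∈ X) :
    (∀ (n T : ℕ) (j : Fin q), Integrable (fun ω =>
        (otpPredict Θ γ θ₀ pts ghat φ n T x ω j - optSol Θ f x j) ^ 2) P) ∧
    ∃ C : ℝ, 0 < C ∧ ∀ n T : ℕ, 0 < n → 0 < T → Identifiable φ (pts n) → ∀ j : Fin q,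
      ∫ ω, (otpPredict Θ γ θ₀ pts ghat φ n T x ω j - optSol Θ f x j) ^ 2 ∂P
        ≤ C * (logFactor T ^ 4 * mseOrder n T) := by
  obtain ⟨K, R, hK, hb⟩ := exists_average_bounds hsmooth hint hlin ⟨x, hx⟩ hγ P K₂
  obtain ⟨c, hc, hw⟩ := exists_lrWeight_bound hφ hpts hwell hx
  have hle : ∀ n i, (⨆ t, (ℱ n i t : MeasurableSpace Ω)) ≤ mΩ := fun n i =>
    iSup_le fun t => (ℱ n i).le t
  have hb' := fun n i T j => hb (pts n i) (ℱ n i) (θ₀ (pts n i)) (ghat n i) (hpts n i)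
    (hθ₀ _ (hpts n i)) (hnoise n i) T j
  have hmem : ∀ n i T j (p : ℝ≥0∞), MemLp (fun ω =>
      prAverage Θ γ (θ₀ (pts n i)) (ghat n i) T ω j - optSol Θ f (pts n i) j) p P :=
    fun n i T j p => MemLp.of_bound ((hb' n i T j).1.mono (hle n i)).aestronglyMeasurable R
      (ae_of_all _ (hb' n i T j).2.1)
  refine ⟨fun n T j => ?_, c ^ 2 * (K ^ 2 + K) + 1, by positivity, fun n T hn hT hid j => ?_⟩
  -- No identifiability is needed here: for any weights the prediction is a finite linear
  -- combination of bounded variables.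
  · have h1 : MemLp (fun ω => ∑ i, lrWeight φ (pts n) x i *
        prAverage Θ γ (θ₀ (pts n i)) (ghat n i) T ω j) 2 P := by
      refine memLp_finsetSum _ fun i _ => MemLp.const_mul ?_ _
      have := (hmem n i T j 2).add (memLp_const (optSol Θ f (pts n i) j))
      simpa [Pi.add_def] using this
    have h2 := (h1.sub (memLp_const (optSol Θ f x j))).integrable_sq
    simpa only [otpPredict, lrPredict_apply, Pi.sub_apply] using h2
  · simp only [otpPredict_sub_optSol hspec hpts hid T hx]
    have hℓ := one_le_logFactor T
    have hℓ0 := logFactor_pos T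
    have hT' : (0 : ℝ) < T := by exact_mod_cast hT
    have hn' : (0 : ℝ) < n := by exact_mod_cast hn
    refine (integral_sq_weighted_sum_le (v := K * (logFactor T / (T + 1))) (by positivity) hc
      (fun i => hmem n i T j 2) (fun i k hik => ?_) (hw n) (fun i => (hb' n i T j).2.2.1)
      (fun i => (hb' n i T j).2.2.2)).trans ?_
    · refine (IndepFun_iff_Indep _ _ _).2 ?_
      exact indep_of_indep_of_le_left (indep_of_indep_of_le_right ((hindep n).indep hik)
        (hb' n k T j).1.measurable.comap_le) (hb' n i T j).1.measurable.comap_le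
    -- The squared bias carries four logarithms and the variance one; the fourth power covers both.
    · have h1 : (K * (logFactor T ^ 2 / (T + 1))) ^ 2 ≤ K ^ 2 * (logFactor T ^ 4 * (1 / T ^ 2)) := by
        calc _ ≤ (K * (logFactor T ^ 2 / T)) ^ 2 := by gcongr; linarith
          _ = _ := by ring
      have h2 : K * (logFactor T / (T + 1)) / n ≤ K * (logFactor T ^ 4 * (1 / (n * T))) := by
        calc _ ≤ K * (logFactor T ^ 4 / T) / n := by
              gcongr
              · exact le_self_pow₀ hℓ (by norm_num)
              · linarith
          _ = _ := by field_simp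
      have h3 : 0 ≤ logFactor T ^ 4 * (1 / (T : ℝ) ^ 2) := by positivity
      have h4 : 0 ≤ logFactor T ^ 4 * (1 / ((n : ℝ) * T)) := by positivity
      calc _ ≤ c ^ 2 * (K ^ 2 * (logFactor T ^ 4 * (1 / (T : ℝ) ^ 2))
            + K * (logFactor T ^ 4 * (1 / (n * T)))) := by gcongr
        _ ≤ c ^ 2 * ((K ^ 2 + K) * (logFactor T ^ 4 * (1 / (T : ℝ) ^ 2))
            + (K ^ 2 + K) * (logFactor T ^ 4 * (1 / (n * T)))) := by
            gcongr
            · linarith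
            · linarith [sq_nonneg K]
        _ = c ^ 2 * (K ^ 2 + K) * (logFactor T ^ 4 * mseOrder n T) := by
            rw [mseOrder]; ring
        _ ≤ _ := by
            have : 0 ≤ logFactor T ^ 4 * mseOrder n T := by
              rw [mseOrder]; positivity
            gcongr
            linarith

/-! ### Asymptotics -/

lemma logFactor_le_three_mul_log {t : ℕ} (ht : 4 ≤ t) : logFactor t ≤ 3 * Real.log t := by
  have ht' : (4 : ℝ) ≤ t := by exact_mod_cast ht
  have h1 : 1 ≤ Real.log t := by
    rw [Real.le_log_iff_exp_le (by linarith)]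
    linarith [Real.exp_one_lt_d9]
  have h2 : Real.log (t + 1) ≤ 2 * Real.log t := by
    rw [← Real.log_rpow (by linarith)]
    refine Real.log_le_log (by linarith) ?_
    norm_num
    nlinarith
  unfold logFactor
  linarith

/-- The logarithms of T must be expressed through the rate a itself. As a ≤ 2/T, for T ≥ 4 one has
|log a| ≥ log T - log 2 ≥ (log T)/2. -/
lemma isSoftO_of_le_logFactor {u : ℕ × ℕ → ℝ} {C : ℝ} (hC : 0 < C)
    (hu : ∀ᶠ p : ℕ × ℕ in atTop ×ˢ atTop, |u p| ≤ C * (logFactor p.2 ^ 4 * mseOrder p.1 p.2)) :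
    IsSoftO (atTop ×ˢ atTop) u fun p => mseOrder p.1 p.2 := by
  refine ⟨4, by norm_num, IsBigO.of_bound (C * 6 ^ 4) ?_⟩
  have hn : ∀ᶠ p : ℕ × ℕ in atTop ×ˢ atTop, 1 ≤ p.1 :=
    (eventually_ge_atTop 1).prod_inl (atTop : Filter ℕ)
  have hT : ∀ᶠ p : ℕ × ℕ in atTop ×ˢ atTop, 4 ≤ p.2 :=
    (eventually_ge_atTop 4).prod_inr (atTop : Filter ℕ)
  filter_upwards [hu, hn, hT] with p hp hn hT
  obtain ⟨n, T⟩ := p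
  simp only at hp hn hT ⊢
  have hT' : (4 : ℝ) ≤ T := by exact_mod_cast hT
  have hn' : (1 : ℝ) ≤ n := by exact_mod_cast hn
  set a := mseOrder n T with ha
  have ha0 : 0 < a := by rw [ha, mseOrder]; positivity
  have ha2 : a ≤ 2 / T := by
    have h1 : 1 / (T : ℝ) ^ 2 ≤ 1 / T := by
      gcongr
      nlinarith
    have h2 : 1 / ((n : ℝ) * T) ≤ 1 / T := by
      gcongr
      nlinarith
    rw [ha, mseOrder]
    calc _ ≤ 1 / (T : ℝ) + 1 / T := add_le_add h1 h2
      _ = _ := by ring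
  have hlog : logFactor T ≤ 6 * |Real.log a| := by
    have h1 : Real.log a ≤ Real.log 2 - Real.log T := by
      rw [← Real.log_div (by norm_num) (by positivity)]
      exact Real.log_le_log ha0 ha2
    have h2 : 2 * Real.log 2 ≤ Real.log T := by
      have h : Real.log ((2 : ℝ) ^ 2) ≤ Real.log T :=
        Real.log_le_log (by norm_num) (by norm_num; exact hT)
      rw [Real.log_pow] at h
      exact_mod_cast h
    have h3 := logFactor_le_three_mul_log hT
    have h4 := neg_abs_le (Real.log a)
    linarith
  rw [Real.norm_eq_abs, Real.norm_of_nonneg (by positivity)]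
  have h4 : |Real.log a| ^ (4 : ℝ) = |Real.log a| ^ 4 := by
    exact_mod_cast Real.rpow_natCast |Real.log a| 4
  rw [h4]
  have hℓ := (logFactor_pos T).le
  calc |u (n, T)| ≤ C * (logFactor T ^ 4 * a) := hp
    _ ≤ C * ((6 * |Real.log a|) ^ 4 * a) := by gcongr
    _ = _ := by ring

/-- Optimal allocations are those with `T ≳ Γ^{1/2}`. -/
lemma optimalAllocation_iff {n T : ℕ → ℕ} (hΓ : Tendsto (fun k => n k * T k) atTop atTop) :
    OptimalAllocation n T ↔
      (fun k => ((n k * T k : ℕ) : ℝ) ^ (1 / 2 : ℝ)) =O[atTop] fun k => (T k : ℝ) := by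
  have hpos : ∀ᶠ k in atTop, 0 < (n k : ℝ) ∧ 0 < (T k : ℝ) := by
    filter_upwards [hΓ.eventually_ge_atTop 1] with k hk
    constructor
    · have : 0 < n k := Nat.pos_of_ne_zero (by rintro h; simp [h] at hk)
      exact_mod_cast this
    · have : 0 < T k := Nat.pos_of_ne_zero (by rintro h; simp [h] at hk)
      exact_mod_cast this
  simp only [← Real.sqrt_eq_rpow]
  constructor
  · rintro ⟨C, hC, h⟩
    refine IsBigO.of_bound (√(2 * C)) ?_
    filter_upwards [h, hpos] with k hk ⟨hn, hT⟩
    have hG : 0 < (n k : ℝ) * T k := by positivity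
    -- The balanced split n' = T' = √Γ has value 2/Γ, so comparison with it forces 1/T² ≤ 2C/Γ.
    have h1 := hk (√(n k * T k)) (√(n k * T k)) (Real.sqrt_pos.2 hG) (Real.sqrt_pos.2 hG)
      (Real.mul_self_sqrt hG.le)
    rw [mseOrder, mseOrder, Real.sq_sqrt hG.le, Real.mul_self_sqrt hG.le] at h1
    have h2 : 1 / (T k : ℝ) ^ 2 ≤ 2 * C / (n k * T k) := by
      have : 0 ≤ 1 / ((n k : ℝ) * T k) := by positivity
      calc _ ≤ C * (1 / ((n k : ℝ) * T k) + 1 / (n k * T k)) := by linarith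
        _ = _ := by ring
    rw [div_le_div_iff₀ (by positivity) hG, one_mul] at h2
    push_cast
    rw [Real.norm_of_nonneg (Real.sqrt_nonneg _), Real.norm_of_nonneg hT.le]
    calc √(n k * T k) ≤ √(2 * C * (T k : ℝ) ^ 2) := Real.sqrt_le_sqrt h2
      _ = √(2 * C) * T k := by rw [Real.sqrt_mul (by positivity), Real.sqrt_sq hT.le]
  · intro h
    obtain ⟨c, hc, hb⟩ := h.exists_pos
    refine ⟨c ^ 2 + 1, by positivity, ?_⟩
    filter_upwards [hb.bound, hpos] with k hk ⟨hn, hT⟩ n' T' hn' hT' he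
    have hG : 0 < (n k : ℝ) * T k := by positivity
    push_cast at hk
    rw [Real.norm_of_nonneg (Real.sqrt_nonneg _), Real.norm_of_nonneg hT.le] at hk
    have h1 : (n k : ℝ) * T k ≤ c ^ 2 * (T k : ℝ) ^ 2 := by
      rw [← mul_pow, ← Real.sq_sqrt hG.le]
      gcongr
    -- Every competitor has value at least 1/Γ, so bounding 1/T² by a multiple of 1/Γ suffices.
    have h2 : 1 / (T k : ℝ) ^ 2 ≤ c ^ 2 * (1 / (n k * T k)) := by
      rw [mul_one_div, div_le_div_iff₀ (by positivity) hG, one_mul]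
      exact h1
    have h3 : 0 ≤ 1 / T' ^ 2 := by positivity
    rw [mseOrder, mseOrder, he]
    have h4 : 0 ≤ (c ^ 2 + 1) * (1 / T' ^ 2) := by positivity
    linarith

lemma IsBigOP.tendstoInMeasure {Ω ι : Type*} [MeasurableSpace Ω] {P : Measure Ω} {l : Filter ι}
    {Z : ι → Ω → ℝ} {a : ι → ℝ} (h : IsBigOP P l Z a) (ha : Tendsto a l (𝓝 0)) :
    TendstoInMeasure P Z l fun _ => 0 := by
  rw [tendstoInMeasure_iff_dist]
  intro ε hε
  rw [ENNReal.tendsto_nhds_zero]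
  intro δ hδ
  obtain ⟨δ', hδ', hδδ⟩ : ∃ δ' : ℝ, 0 < δ' ∧ ENNReal.ofReal δ' ≤ δ := by
    rcases eq_or_ne δ ∞ with rfl | hne
    · exact ⟨1, one_pos, le_top⟩
    · exact ⟨δ.toReal, ENNReal.toReal_pos hδ.ne' hne, ENNReal.ofReal_toReal_le⟩
  obtain ⟨M, hM, hev⟩ := h δ' hδ'
  have hMa : ∀ᶠ i in l, M * a i < ε := by
    have := ha.const_mul M
    rw [mul_zero] at this
    exact this.eventually_lt_const hε
  filter_upwards [hev, hMa] with i hi hMi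
  refine le_trans (measure_mono fun ω hω => ?_) (hi.le.trans hδδ)
  simp only [Set.mem_ofPred_eq, Real.dist_eq, sub_zero] at hω ⊢
  exact hMi.trans_le hω

/-- A quadratic bound near the target and a vanishing mean squared error give a stochastic
order. -/
lemma isBigOP_of_local_quadratic {Ω ι : Type*} [MeasurableSpace Ω] {P : Measure Ω}
    [IsProbabilityMeasure P] {l : Filter ι} {Z e : ι → Ω → ℝ} {v : ι → ℝ} {C D r : ℝ}
    (hC : 0 < C) (hD : 0 < D) (hr : 0 < r) (he0 : ∀ i ω, 0 ≤ e i ω)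
    (hei : ∀ i, Integrable (e i) P)
    (hZ : ∀ i ω, e i ω ≤ r → |Z i ω| ≤ C * e i ω) (hv : ∀ᶠ i in l, 0 < v i)
    (hv0 : Tendsto v l (𝓝 0)) (he : ∀ᶠ i in l, ∫ ω, e i ω ∂P ≤ D * v i) :
    IsBigOP P l Z v := by
  intro δ hδ
  set M := 4 * C * D / δ with hM
  have hM0 : 0 < M := by positivity
  refine ⟨M, hM0, ?_⟩
  have hsmall : ∀ᶠ i in l, D * v i < r * δ / 4 := by
    have := hv0.const_mul D
    rw [mul_zero] at this
    exact this.eventually_lt_const (by positivity)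
  filter_upwards [hv, he, hsmall] with i hvi hei' hsi
  -- Either the error leaves the region where the quadratic bound holds, or a large `Z` forces a
  -- large `e`. By Markov's inequality and the choice of `M`, each event has probability at most
  -- δ/4, and the sum is strictly below δ.
  have hsub : {ω | M * v i < |Z i ω|} ⊆ {ω | r ≤ e i ω} ∪ {ω | M * v i / C ≤ e i ω} := by
    intro ω hω
    simp only [Set.mem_union, Set.mem_ofPred_eq] at hω ⊢
    by_cases h : r ≤ e i ω
    · exact Or.inl h
    · right
      have := hZ i ω (not_le.1 h).le
      rw [div_le_iff₀ hC]
      linarith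
  have h1 := mul_meas_ge_le_integral_of_nonneg (μ := P) (ae_of_all _ (he0 i)) (hei i) r
  have h2 := mul_meas_ge_le_integral_of_nonneg (μ := P) (ae_of_all _ (he0 i)) (hei i)
    (M * v i / C)
  have h3 : P.real {ω | r ≤ e i ω} ≤ δ / 4 := by
    refine le_of_mul_le_mul_left ?_ hr
    linarith
  have h4 : P.real {ω | M * v i / C ≤ e i ω} ≤ δ / 4 := by
    have hp : 0 < M * v i / C := by positivity
    refine le_of_mul_le_mul_left ?_ hp
    refine (h2.trans hei').trans (le_of_eq ?_)
    rw [hM]; field_simp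
  have h5 : P.real {ω | M * v i < |Z i ω|} < δ := by
    have := (measureReal_mono (μ := P) hsub).trans (measureReal_union_le _ _)
    linarith
  rw [← ofReal_measureReal]
  exact (ENNReal.ofReal_lt_ofReal_iff hδ).2 h5


/-- The rate `q / Γ`, up to logarithms, vanishes and dominates the logarithmic factors. -/
lemma budget_rate {q : ℕ} (hq : 0 < q) {G : ℕ → ℕ} (hG : Tendsto G atTop atTop) :
    Tendsto (fun k => (q : ℝ) * (G k : ℝ)⁻¹ * |Real.log ((q : ℝ) * (G k : ℝ)⁻¹)| ^ (4 : ℝ)) atTop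
      (𝓝 0) ∧
    ∀ᶠ k in atTop, 0 < |Real.log ((q : ℝ) * (G k : ℝ)⁻¹)| ∧
      logFactor (G k) ≤ 6 * |Real.log ((q : ℝ) * (G k : ℝ)⁻¹)| := by
  have hq' : (0 : ℝ) < q := by exact_mod_cast hq
  have hGr : Tendsto (fun k => (G k : ℝ)) atTop atTop := tendsto_natCast_atTop_atTop.comp hG
  constructor
  -- a |log a|⁴ is the fourth power of |log a · a^{1/4}|, which vanishes as a → 0⁺.
  · have h1 := (tendsto_log_mul_rpow_nhdsGT_zero (r := 1 / 4) (by norm_num)).abs.pow 4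
    have h2 : Tendsto (fun k => (q : ℝ) * (G k : ℝ)⁻¹) atTop (𝓝[>] 0) := by
      refine tendsto_nhdsWithin_iff.2 ⟨?_, ?_⟩
      · simpa using hGr.inv_tendsto_atTop.const_mul (q : ℝ)
      · filter_upwards [hGr.eventually_gt_atTop 0] with k hk
        exact mul_pos hq' (inv_pos.2 hk)
    have h3 := h1.comp h2
    simp only [abs_zero, ne_eq, OfNat.ofNat_ne_zero, not_false_eq_true, zero_pow] at h3
    refine h3.congr' ?_
    filter_upwards [hGr.eventually_gt_atTop 0] with k hk
    have ha : 0 < (q : ℝ) * (G k : ℝ)⁻¹ := mul_pos hq' (inv_pos.2 hk)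
    simp only [Function.comp]
    set a := (q : ℝ) * (G k : ℝ)⁻¹
    have e1 : (a ^ (1 / 4 : ℝ)) ^ 4 = a := by
      rw [← Real.rpow_natCast, ← Real.rpow_mul ha.le]
      norm_num
    have e2 : |Real.log a| ^ (4 : ℝ) = |Real.log a| ^ 4 := by
      exact_mod_cast Real.rpow_natCast |Real.log a| 4
    rw [abs_mul, mul_pow, abs_of_pos (Real.rpow_pos_of_pos ha _), e1, e2, mul_comm]
  · filter_upwards [hG.eventually_ge_atTop 4, hGr.eventually_ge_atTop ((q : ℝ) ^ 2)] with k h4 hq2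
    have hk : (0 : ℝ) < G k := by
      have : 0 < G k := by omega
      exact_mod_cast this
    have h1 := logFactor_le_three_mul_log h4
    have h2 := one_le_logFactor (G k)
    -- Once Γ ≥ q², |log(q/Γ)| is at least (log Γ)/2.
    have h3 : 2 * Real.log q ≤ Real.log (G k) := by
      have h : Real.log ((q : ℝ) ^ 2) ≤ Real.log (G k) := Real.log_le_log (by positivity) hq2
      rw [Real.log_pow] at h
      exact_mod_cast h
    have h5 : Real.log ((q : ℝ) * (G k : ℝ)⁻¹) = Real.log q - Real.log (G k) := by
      rw [Real.log_mul hq'.ne' (inv_ne_zero hk.ne'), Real.log_inv]; ring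
    have h6 := neg_abs_le (Real.log ((q : ℝ) * (G k : ℝ)⁻¹))
    constructor <;> linarith

end OTP

end

/-! ### The main theorem -/

theorem theorem3
    {q d s : ℕ}
    -- the simulation optimization problem
    {S : Type*} [MeasurableSpace S] (ν : Measure S) [IsProbabilityMeasure ν]
    (F : OTP.E q → OTP.E d → S → ℝ) (f : OTP.E q → OTP.E d → ℝ) (hf : f = OTP.objective ν F)
    (Θ : Set (OTP.E q)) (X : Set (OTP.E d))
    (hF : ∀ θ ∈ Θ, ∀ x ∈ X, Integrable (F θ x) ν)
    (hsmooth : OTP.SmoothStronglyConvex Θ X f)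
    (hint : OTP.InteriorOptimum Θ X f)
    (hlin : OTP.LocalLinearization Θ X f)
    -- the design, the SGD runs at the design points, and the basis
    (pts : (n : ℕ) → Fin n → OTP.E d) (hpts : OTP.QuasiUniform X pts)
    (γ : ℕ → ℝ) (hγ : OTP.StepSize γ)
    (θ₀ : OTP.E d → OTP.E q) (hθ₀ : ∀ x ∈ X, θ₀ x ∈ Θ)
    {Ω : Type*} [mΩ : MeasurableSpace Ω] (P : Measure Ω) [IsProbabilityMeasure P]
    (ghat : (n : ℕ) → Fin n → ℕ → OTP.E q → Ω → OTP.E q)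
    (ℱ : (n : ℕ) → Fin n → Filtration ℕ mΩ)
    (K₂ : ℝ)
    (hnoise : ∀ n i,
      OTP.MartingaleNoise P (ℱ n i) Θ f (pts n i) γ (θ₀ (pts n i)) (ghat n i) K₂)
    (hindep : ∀ n, iIndep (fun i => ⨆ t, (ℱ n i t : MeasurableSpace Ω)) P)
    (φ : OTP.E d → Fin s → ℝ)
    (hφ : OTP.BoundedBasis X φ)
    (hwell : OTP.WellConditioned φ pts)
    (hspec : OTP.CorrectlySpecified Θ X f φ)
    -- the target covariate
    (x : OTP.E d) (hx : x ∈ X) :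
    -- the componentwise mean squared error is `Õ(1/T² + 1/(nT))` as `n` and `T` tend to infinity
    (∀ j : Fin q,
      (∀ n T : ℕ, Integrable (fun ω =>
        (OTP.otpPredict Θ γ θ₀ pts ghat φ n T x ω j - OTP.optSol Θ f x j) ^ 2) P) ∧
      OTP.IsSoftO (atTop ×ˢ atTop : Filter (ℕ × ℕ))
        (fun p => ∫ ω,
          (OTP.otpPredict Θ γ θ₀ pts ghat φ p.1 p.2 x ω j - OTP.optSol Θ f x j) ^ 2 ∂P)
        (fun p => OTP.mseOrder p.1 p.2)) ∧
    -- for all allocations `(n k, T k)` of budgets `Γ k = n k * T k` that tend to infinity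
    ∀ n T : ℕ → ℕ, Tendsto (fun k => n k * T k) atTop atTop →
      -- the allocation is optimal iff `T ≳ Γ^{1/2}`
      (OTP.OptimalAllocation n T ↔
        (fun k => ((n k * T k : ℕ) : ℝ) ^ (1 / 2 : ℝ)) =O[atTop] fun k => (T k : ℝ)) ∧
      -- and under an optimal allocation the optimality gap tends to `0` in probability,
      -- at the rate `Õ_P(q Γ⁻¹)`
      ((fun k => ((n k * T k : ℕ) : ℝ) ^ (1 / 2 : ℝ)) =O[atTop] (fun k => (T k : ℝ)) →
        (∀ᶠ k in atTop, OTP.Identifiable φ (pts (n k))) →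
        TendstoInMeasure P
          (fun k ω => f (OTP.otpPredict Θ γ θ₀ pts ghat φ (n k) (T k) x ω) x
            - f (OTP.optSol Θ f x) x) atTop (fun _ => 0) ∧
        OTP.IsSoftOP P atTop
          (fun k ω => f (OTP.otpPredict Θ γ θ₀ pts ghat φ (n k) (T k) x ω) x
            - f (OTP.optSol Θ f x) x)
          (fun k => (q : ℝ) * ((n k * T k : ℕ) : ℝ)⁻¹)) := by
  obtain ⟨hInt, C, hC, hmse⟩ := OTP.exists_mse_bound hsmooth hint hlin hpts.mem hγ hθ₀ P hnoise
    hindep hφ hwell hspec hx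
  refine ⟨fun j => ⟨fun n T => hInt n T j, ?_⟩, fun n T hΓ =>
    ⟨OTP.optimalAllocation_iff hΓ, fun hT hid => ?_⟩⟩
  · obtain ⟨κ, hκ⟩ := hwell
    refine OTP.isSoftO_of_le_logFactor hC ?_
    filter_upwards [(hκ.and (eventually_ge_atTop 1)).prod_inl (atTop : Filter ℕ),
      (eventually_ge_atTop 1).prod_inr (atTop : Filter ℕ)] with p hp hpT
    rw [abs_of_nonneg (integral_nonneg fun ω => sq_nonneg _)]
    exact hmse p.1 p.2 hp.2 hpT hp.1.1 j
  rcases Nat.eq_zero_or_pos q with rfl | hq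
  -- For q = 0 the claimed rate is identically zero, but so is the gap, because the decision space
  -- is a single point.
  · have hz : ∀ k ω, f (OTP.otpPredict Θ γ θ₀ pts ghat φ (n k) (T k) x ω) x
        - f (OTP.optSol Θ f x) x = 0 := fun k ω => by
      rw [Subsingleton.elim (OTP.otpPredict Θ γ θ₀ pts ghat φ (n k) (T k) x ω)
        (OTP.optSol Θ f x), sub_self]
    simp only [hz]
    have hO : OTP.IsBigOP P atTop (fun (_ : ℕ) (_ : Ω) => (0 : ℝ)) fun _ => 0 :=
      fun δ hδ => ⟨1, one_pos, Eventually.of_forall fun k => by simpa using hδ⟩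
    refine ⟨hO.tendstoInMeasure tendsto_const_nhds, 1, one_pos, ?_⟩
    simpa using hO
  -- The parameter `H` enters only the linearization clause, which plays no role in this step, so 0
  -- will do.
  · obtain ⟨R, r, μ, L, B, -, hr, -, -, hB, hreg⟩ :=
      OTP.exists_regularField hsmooth hint hlin ⟨x, hx⟩ 0
    obtain ⟨G, hG⟩ := hreg x hx
    obtain ⟨hv0, hlog⟩ := OTP.budget_rate hq hΓ
    have hq' : (0 : ℝ) < q := by exact_mod_cast hq
    have hpos : ∀ᶠ k in atTop, 0 < n k ∧ 0 < T k := by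
      filter_upwards [hΓ.eventually_ge_atTop 1] with k hk
      exact CanonicallyOrderedAdd.mul_pos.1 hk
    have hnorm : ∀ k ω, ‖OTP.otpPredict Θ γ θ₀ pts ghat φ (n k) (T k) x ω - OTP.optSol Θ f x‖ ^ 2
        = ∑ j, (OTP.otpPredict Θ γ θ₀ pts ghat φ (n k) (T k) x ω j
          - OTP.optSol Θ f x j) ^ 2 := fun k ω => by
      rw [EuclideanSpace.real_norm_sq_eq]
      rfl
    obtain ⟨c, hc, hTb⟩ := hT.exists_pos
    have hO := OTP.isBigOP_of_local_quadratic (P := P) (l := atTop)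
      (Z := fun k ω => f (OTP.otpPredict Θ γ θ₀ pts ghat φ (n k) (T k) x ω) x
        - f (OTP.optSol Θ f x) x)
      (e := fun k ω =>
        ‖OTP.otpPredict Θ γ θ₀ pts ghat φ (n k) (T k) x ω - OTP.optSol Θ f x‖ ^ 2)
      (v := fun k => (q : ℝ) * ((n k * T k : ℕ) : ℝ)⁻¹
        * |Real.log ((q : ℝ) * ((n k * T k : ℕ) : ℝ)⁻¹)| ^ (4 : ℝ))
      (C := B + 1) (D := C * 6 ^ 4 * (c ^ 2 + 1)) (r := r ^ 2) (by positivity) (by positivity)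
      (by positivity) (fun k ω => sq_nonneg _) (fun k => ?_) (fun k ω he => ?_) ?_ hv0 ?_
    · exact ⟨hO.tendstoInMeasure hv0, 4, by norm_num, hO⟩
    · simp only [hnorm]
      exact integrable_finsetSum _ fun j _ => hInt (n k) (T k) j
    · set θ := OTP.otpPredict Θ γ θ₀ pts ghat φ (n k) (T k) x ω
      -- The prediction need not lie in Θ, so the gap is controlled only near the optimum. There
      -- convexity bounds it by ‖∇f(θ)‖ ‖θ - θ_*‖, and the gradient is O(‖θ - θ_*‖).
      have hd : ‖θ - OTP.optSol Θ f x‖ ≤ r := le_of_sq_le_sq he hr.le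
      have hθ : θ ∈ Θ := hG.ball_subset (mem_closedBall_iff_norm.2 hd)
      have h1 := OTP.optSol_isMinOn hsmooth hint hx hθ
      have h2 := hsmooth.add_inner_le hx hθ (OTP.optSol_mem hint hx)
      have h3 := (abs_real_inner_le_norm (OTP.gradθ Θ f θ x) (OTP.optSol Θ f x - θ)).trans
        (mul_le_mul_of_nonneg_right (hG.local_growth θ hd) (norm_nonneg _))
      rw [norm_sub_rev (OTP.optSol Θ f x) θ] at h3
      have h4 := neg_abs_le (inner ℝ (OTP.gradθ Θ f θ x) (OTP.optSol Θ f x - θ))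
      rw [abs_of_nonneg (by linarith)]
      nlinarith [sq_nonneg ‖θ - OTP.optSol Θ f x‖]
    · filter_upwards [hlog, hΓ.eventually_ge_atTop 1] with k hk hk1
      have : (0 : ℝ) < ((n k * T k : ℕ) : ℝ) := by exact_mod_cast hk1
      have := Real.rpow_pos_of_pos hk.1 4
      positivity
    · filter_upwards [hlog, hpos, hid, hTb.bound] with k hk ⟨hn, hT0⟩ hidk hcT
      have hn' : (0 : ℝ) < n k := by exact_mod_cast hn
      have hT' : (0 : ℝ) < T k := by exact_mod_cast hT0
      have hGam : (0 : ℝ) < ((n k * T k : ℕ) : ℝ) := by push_cast; positivity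
      set Γ : ℝ := ((n k * T k : ℕ) : ℝ) with hΓdef
      set l := |Real.log ((q : ℝ) * Γ⁻¹)| with hl
      have hl4 : l ^ (4 : ℝ) = l ^ 4 := by exact_mod_cast Real.rpow_natCast l 4
      -- Since n ≥ 1, T ≤ Γ, so logarithms of T are dominated by logarithms of the budget.
      have hfac : OTP.logFactor (T k) ≤ 6 * l :=
        (OTP.logFactor_mono (Nat.le_mul_of_pos_left (T k) hn)).trans hk.2
      have hord : OTP.mseOrder (n k) (T k) ≤ (c ^ 2 + 1) * Γ⁻¹ := by
        rw [← Real.sqrt_eq_rpow, Real.norm_of_nonneg (Real.sqrt_nonneg _),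
          Real.norm_of_nonneg hT'.le] at hcT
        have h1 : Γ ≤ c ^ 2 * (T k : ℝ) ^ 2 := by
          rw [← mul_pow, ← Real.sq_sqrt hGam.le]
          gcongr
        have h2 : 1 / (T k : ℝ) ^ 2 ≤ c ^ 2 * Γ⁻¹ := by
          rw [← div_eq_mul_inv, div_le_div_iff₀ (by positivity) hGam, one_mul]
          exact h1
        have h3 : 1 / ((n k : ℝ) * T k) = Γ⁻¹ := by rw [hΓdef]; push_cast; rw [one_div]
        rw [OTP.mseOrder, h3]
        linarith
      have hord0 : 0 ≤ OTP.mseOrder (n k) (T k) := by rw [OTP.mseOrder]; positivity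
      simp only [hnorm]
      rw [integral_finsetSum _ fun j _ => hInt (n k) (T k) j]
      calc _ ≤ ∑ _j : Fin q, C * ((6 * l) ^ 4 * ((c ^ 2 + 1) * Γ⁻¹)) := by
            refine Finset.sum_le_sum fun j _ => (hmse (n k) (T k) hn hT0 hidk j).trans ?_
            have := (OTP.logFactor_pos (T k)).le
            gcongr
        _ = _ := by
            rw [hl4]
            simp only [Finset.sum_const, Finset.card_univ, Fintype.card_fin, nsmul_eq_mul]
            ring
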